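/- For $r>0$ let $D_r\subset\mathbb{R}^2$ be the closed disk of radius $r$ centered at the origin, and let $0<a<b$. Let $\mathscr{C}_{a,b}$ be the class of convex sets $K\subseteq\mathbb{R}^2$ with $D_a\subseteq K\subseteq D_b$. For $\lambda\in\mathbb{R}$ put $J_\lambda(K)=\lambda|K|-P(K)$, where $|K|$ is the area of $K$ and $P(K)$ its perimeter. A set $\Omega\in\mathscr{C}_{a,b}$ is called optimal (for $\lambda$) if $J_\lambda(\Omega)\le J_\lambda(K)$ for every $K\in\mathscr{C}_{a,b}$. For $N\ge 3$, a quasi-regular $N$-gon is a convex polygon with exactly $N$ sides, $N-1$ of which have the same length, while the remaining one has a different length. If $\frac{1}{2b}<\lambda\le\frac{1}{a+b}$, then there is at most one $N\in\mathbb{N}$ such that some optimal set for $\lambda$ is a quasi-regular $N$-gon. -/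

import Mathlib

open MeasureTheory
open scoped MeasureTheory

/-- The Euclidean plane. -/
abbrev Plane : Type := EuclideanSpace ℝ (Fin 2)

/-- The class of convex subsets `K` of the plane with `D_a ⊆ K ⊆ D_b`, where `D_r` is the disk of
radius `r` centered at the origin. -/
def annularConvexClass (a b : ℝ) : Set (Set Plane) :=
  {K | Convex ℝ K ∧ Metric.closedBall (0 : Plane) a ⊆ K ∧ K ⊆ Metric.closedBall (0 : Plane) b}

/-- The area of a planar set (Lebesgue measure). -/
noncomputable def area (K : Set Plane) : ℝ := (volume K).toReal

/-- The perimeter of a planar convex set with nonempty interior: the length, that is the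
one-dimensional Hausdorff measure (normalized so that a segment has its usual length), of the
topological boundary. -/
noncomputable def perimeter (K : Set Plane) : ℝ := (μH[1] (frontier K)).toReal

/-- The functional `J(K) = lam * area K - perimeter K`. -/
noncomputable def functionalJ (lam : ℝ) (K : Set Plane) : ℝ := lam * area K - perimeter K

/-- `K` is an optimal set: it minimizes `functionalJ lam` over the class of convex sets
between `D_a` and `D_b`. -/
def IsOptimalSet (a b lam : ℝ) (K : Set Plane) : Prop :=
  K ∈ annularConvexClass a b ∧ IsMinOn (functionalJ lam) (annularConvexClass a b) K

/-- The determinant of two plane vectors; it is positive iff `v` points strictly to the left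
of `u`. -/
def planeDet (u v : Plane) : ℝ := u 0 * v 1 - u 1 * v 0

/-- The vertices of `p` are the `n ≥ 3` vertices of a (nondegenerate) convex `n`-gon, listed
counterclockwise: all the vertices other than the two endpoints of a side lie strictly to the left
of the line carrying that side. In particular the vertices are distinct, no angle is flat, and the
sides of the convex hull are exactly the `n` segments joining consecutive vertices. -/
def IsConvexNGon {n : ℕ} (p : Polygon Plane n) : Prop :=
  3 ≤ n ∧ ∀ i k : Fin n, k ≠ i → k ≠ finRotate n i →
    0 < planeDet (p (finRotate n i) - p i) (p k - p i)

/-- The length of the `i`-th side. -/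
noncomputable def sideLength {n : ℕ} (p : Polygon Plane n) (i : Fin n) : ℝ :=
  dist (p i) (p (finRotate n i))

/-- `K` is a quasi-regular `n`-gon: a convex `n`-gon all of whose sides have equal length,
except one, whose length is different. -/
def IsQuasiRegularNGon (n : ℕ) (K : Set Plane) : Prop :=
  ∃ p : Polygon Plane n, IsConvexNGon p ∧ K = convexHull ℝ (Set.range p.vertices) ∧
    ∃ (j : Fin n) (l : ℝ), (∀ i : Fin n, i ≠ j → sideLength p i = l) ∧ sideLength p j ≠ l

/-! An optimal quasi-regular N-gon confines `lam * b` to the interval 1/(1 + cos(π/N)) < λb ≤ 1/(1 +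
cos(π/(N-1))) (`IsOptimalSet.localization`). For different N ≥ 3 these intervals are disjoint, so λ
determines N.

The first half of the argument shows that an optimal polygon is inscribed in the outer circle
(`IsOptimalPolygon.norm_eq`). On polygons the functional is a sum over the sides of λ/2 times a
determinant minus a length. When one vertex moves along a line, the area is affine and the perimeter
convex, so the functional is concave and a minimizer cannot have such freedom
(`IsOptimalPolygon.not_free`). Hence both sides at a vertex in the open outer disk are tangent to
the inner disk. Two adjacent vertices of this kind are excluded by pushing their common side outward
(`IsOptimalPolygon.not_both_interior`), an isolated one by prolonging a side up to the outer circle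
(`exists_better_vertex`).

An inscribed polygon is then encoded by half-angles θᵢ with sum π and b cos θᵢ ≥ a, and the
functional becomes the sum of `chordJ b lam (θ i)`. In the quasi-regular case N-1 of the angles
equal α and one is β. The presence of two equal angles forces 2λb cos α ≤ 1, which rules out β > α.
For β < α, the condition λ(a+b) ≤ 1 makes the inner constraint inactive, so that stationarity gives
λb(cos α + cos β) = 1 and the second-order condition gives (N-1) sin β ≤ sin α. One bound on λb
follows from α > π/N, the other from the trigonometric inequality `one_add_cos_le`
(`IsOptimalAngles.localization`). -/

/-! ### Cyclic successor and determinant algebra in the plane. -/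

theorem finRotate_ne_self {n : ℕ} (hn : 2 ≤ n) (i : Fin n) : finRotate n i ≠ i := by
  obtain ⟨m, rfl⟩ : ∃ m, n = m + 2 := ⟨n - 2, by omega⟩
  rw [finRotate_apply]
  simp

theorem finRotate_finRotate_ne_self {n : ℕ} (hn : 3 ≤ n) (i : Fin n) :
    finRotate n (finRotate n i) ≠ i := by
  obtain ⟨m, rfl⟩ : ∃ m, n = m + 3 := ⟨n - 3, by omega⟩
  rw [finRotate_apply, finRotate_apply, add_assoc]
  intro h
  have h2 : (1 + 1 : Fin (m + 3)) = 0 := by simpa using h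
  have := congrArg Fin.val h2
  simp [Fin.val_add, Nat.mod_eq_of_lt (show 2 < m + 3 by omega)] at this

namespace planeDet

@[simp] theorem self (u : Plane) : planeDet u u = 0 := by simp [planeDet]; ring
theorem swap (u v : Plane) : planeDet v u = -planeDet u v := by simp [planeDet]; ring
theorem add_left (u v w : Plane) : planeDet (u + v) w = planeDet u w + planeDet v w := by
  simp [planeDet]; ring
theorem add_right (u v w : Plane) : planeDet u (v + w) = planeDet u v + planeDet u w := by
  simp [planeDet]; ring
theorem sub_left (u v w : Plane) : planeDet (u - v) w = planeDet u w - planeDet v w := by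
  simp [planeDet]; ring
theorem sub_right (u v w : Plane) : planeDet u (v - w) = planeDet u v - planeDet u w := by
  simp [planeDet]; ring
theorem smul_left (r : ℝ) (u v : Plane) : planeDet (r • u) v = r * planeDet u v := by
  simp [planeDet]; ring
theorem smul_right (r : ℝ) (u v : Plane) : planeDet u (r • v) = r * planeDet u v := by
  simp [planeDet]; ring
@[simp] theorem zero_left (u : Plane) : planeDet 0 u = 0 := by simp [planeDet]
@[simp] theorem zero_right (u : Plane) : planeDet u 0 = 0 := by simp [planeDet]

theorem continuous : Continuous fun x : Plane × Plane => planeDet x.1 x.2 := by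
  unfold planeDet; fun_prop

end planeDet

/-- Cramer's rule in the plane. -/
theorem planeDet_smul_eq (u v x : Plane) :
    planeDet u v • x = planeDet x v • u + planeDet u x • v := by
  ext i; fin_cases i <;> simp [planeDet] <;> ring

theorem plane_eq_of_planeDet_ne_zero {u v : Plane} (h : planeDet u v ≠ 0) (x : Plane) :
    x = (planeDet x v / planeDet u v) • u + (planeDet u x / planeDet u v) • v := by
  have := congrArg (fun y => (planeDet u v)⁻¹ • y) (planeDet_smul_eq u v x)
  simp only [smul_add, smul_smul, inv_mul_cancel₀ h, one_smul] at this
  rw [div_eq_inv_mul, div_eq_inv_mul]; exact this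

theorem plane_norm_sq (x : Plane) : ‖x‖ ^ 2 = x 0 ^ 2 + x 1 ^ 2 := by
  rw [EuclideanSpace.norm_sq_eq]; simp [Fin.sum_univ_two]

theorem plane_ext {x y : Plane} (h0 : x 0 = y 0) (h1 : x 1 = y 1) : x = y := by
  ext i; fin_cases i <;> assumption

/-! ### Convex polygons as intersections of half-planes; perimeter. -/

section ConvexNGon

variable {n : ℕ} {p : Polygon Plane n}

/-- The affine function whose nonnegativity means lying to the left of the `i`-th side. -/
noncomputable def sideFun (p : Polygon Plane n) (i : Fin n) (x : Plane) : ℝ :=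
  planeDet (p (finRotate n i) - p i) (x - p i)

/-- The region enclosed by a polygon. -/
noncomputable def polyHull (p : Polygon Plane n) : Set Plane := convexHull ℝ (Set.range p.vertices)

theorem sideFun_lin (p : Polygon Plane n) (i : Fin n) (s t : ℝ) (hst : s + t = 1) (x y : Plane) :
    sideFun p i (s • x + t • y) = s * sideFun p i x + t * sideFun p i y := by
  obtain rfl : s = 1 - t := by linarith
  simp [sideFun, planeDet]; ring

theorem sideFun_continuous (p : Polygon Plane n) (i : Fin n) : Continuous (sideFun p i) := by
  unfold sideFun planeDet; fun_prop

@[simp] theorem sideFun_left (p : Polygon Plane n) (i : Fin n) : sideFun p i (p i) = 0 := by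
  simp [sideFun]

@[simp] theorem sideFun_right (p : Polygon Plane n) (i : Fin n) :
    sideFun p i (p (finRotate n i)) = 0 := by
  simp [sideFun]

theorem sideFun_zero (p : Polygon Plane n) (i : Fin n) :
    sideFun p i 0 = planeDet (p i) (p (finRotate n i)) := by
  simp [sideFun, planeDet]; ring

theorem IsConvexNGon.sideFun_pos (hp : IsConvexNGon p) {i k : Fin n} (h1 : k ≠ i)
    (h2 : k ≠ finRotate n i) : 0 < sideFun p i (p k) := hp.2 i k h1 h2

theorem IsConvexNGon.sideFun_nonneg (hp : IsConvexNGon p) (i k : Fin n) :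
    0 ≤ sideFun p i (p k) := by
  by_cases h1 : k = i
  · simp [h1]
  by_cases h2 : k = finRotate n i
  · rw [h2, sideFun_right]
  exact (hp.sideFun_pos h1 h2).le

theorem polyHull_convex (p : Polygon Plane n) : Convex ℝ (polyHull p) := convex_convexHull _ _

theorem polyHull_isCompact (p : Polygon Plane n) : IsCompact (polyHull p) :=
  (Set.finite_range _).isCompact_convexHull ℝ

theorem vertex_mem_polyHull (p : Polygon Plane n) (i : Fin n) : p i ∈ polyHull p :=
  subset_convexHull _ _ ⟨i, rfl⟩

theorem halfSpace_convex (p : Polygon Plane n) (i : Fin n) :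
    Convex ℝ {x | 0 ≤ sideFun p i x} := by
  intro x hx y hy s t hs ht hst
  simp only [Set.mem_ofPred_eq] at *
  rw [sideFun_lin p i s t hst]
  positivity

/-- The turn at a vertex is to the left. -/
theorem IsConvexNGon.turn_pos (hp : IsConvexNGon p) (i : Fin n) :
    0 < planeDet (p (finRotate n i) - p i)
      (p (finRotate n (finRotate n i)) - p (finRotate n i)) := by
  have := hp.2 i (finRotate n (finRotate n i)) (finRotate_finRotate_ne_self hp.1 i)
    (finRotate_ne_self (by have := hp.1; omega) _)
  simp only [planeDet, PiLp.sub_apply] at *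
  linarith

/-- A convex polygon is the intersection of the half-planes to the left of its sides. -/
theorem IsConvexNGon.mem_polyHull_iff (hp : IsConvexNGon p) (x : Plane) :
    x ∈ polyHull p ↔ ∀ i, 0 ≤ sideFun p i x := by
  constructor
  · intro hx i
    have : polyHull p ⊆ {x | 0 ≤ sideFun p i x} := by
      refine convexHull_min ?_ (halfSpace_convex p i)
      rintro _ ⟨k, rfl⟩
      exact hp.sideFun_nonneg i k
    exact this hx
  · intro hx
    by_contra hxK
    obtain ⟨ℓ, c, h1, h2⟩ := geometric_hahn_banach_closed_point (polyHull_convex p)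
      (polyHull_isCompact p).isClosed hxK
    have : Nonempty (Fin n) := ⟨⟨0, by have := hp.1; omega⟩⟩
    -- At a vertex maximizing the separating functional, the functional is nonnegative on the
    -- incoming side and nonpositive on the outgoing one. In the basis of these two sides, `x` minus
    -- the vertex has a nonpositive first and a nonnegative second coefficient, so the functional at
    -- `x` cannot exceed the maximum.
    obtain ⟨j, hj⟩ := Finite.exists_max (fun k => ℓ (p k))
    obtain ⟨i, rfl⟩ := (finRotate n).surjective j
    have hturn := hp.turn_pos i
    set u := p (finRotate n i) - p i with hu
    set v := p (finRotate n (finRotate n i)) - p (finRotate n i) with hv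
    have e := plane_eq_of_planeDet_ne_zero hturn.ne' (x - p (finRotate n i))
    have a1 : 0 ≤ planeDet u (x - p (finRotate n i)) := by
      have := hx i
      simp only [sideFun, planeDet, PiLp.sub_apply, hu] at *
      linarith
    have a2 : planeDet (x - p (finRotate n i)) v ≤ 0 := by
      have := hx (finRotate n i)
      simp only [sideFun] at this
      rw [planeDet.swap]; linarith
    have l1 : 0 ≤ ℓ u := by
      have := hj i
      rw [hu, map_sub]; linarith
    have l2 : ℓ v ≤ 0 := by
      have := hj (finRotate n (finRotate n i))
      rw [hv, map_sub]; linarith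
    have : ℓ (x - p (finRotate n i)) ≤ 0 := by
      rw [e, map_add, map_smul, map_smul, smul_eq_mul, smul_eq_mul]
      have : planeDet (x - p (finRotate n i)) v / planeDet u v * ℓ u ≤ 0 :=
        mul_nonpos_of_nonpos_of_nonneg (div_nonpos_of_nonpos_of_nonneg a2 hturn.le) l1
      have : planeDet u (x - p (finRotate n i)) / planeDet u v * ℓ v ≤ 0 :=
        mul_nonpos_of_nonneg_of_nonpos (div_nonneg a1 hturn.le) l2
      linarith
    have h3 := h1 _ (vertex_mem_polyHull p (finRotate n i))
    rw [map_sub] at this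
    linarith

theorem IsConvexNGon.side_ne (hp : IsConvexNGon p) (i : Fin n) : p (finRotate n i) - p i ≠ 0 := by
  intro h
  have := hp.turn_pos i
  rw [h, planeDet.zero_left] at this
  exact lt_irrefl _ this

/-- On the line of a side, the half-plane of the previous side bounds the parameter by 0 from below
and that of the next side bounds it by 1 from above. Writing `i` as a successor makes both
neighbours available. -/
theorem IsConvexNGon.mem_segment (hp : IsConvexNGon p) {x : Plane} (hx : x ∈ polyHull p) {i : Fin n}
    (hi : sideFun p i x = 0) : x ∈ segment ℝ (p i) (p (finRotate n i)) := by
  obtain ⟨k, rfl⟩ := (finRotate n).surjective i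
  rw [hp.mem_polyHull_iff] at hx
  have t1 := hp.turn_pos k
  have t2 := hp.turn_pos (finRotate n k)
  have x1 := hx k
  have x3 := hx (finRotate n (finRotate n k))
  simp only [sideFun] at *
  set o := p k
  set u := p (finRotate n k)
  set v := p (finRotate n (finRotate n k))
  set w := p (finRotate n (finRotate n (finRotate n k)))
  have e := plane_eq_of_planeDet_ne_zero t1.ne' (x - u)
  have e2 : planeDet (x - u) (v - u) = 0 := by rw [planeDet.swap, hi]; simp
  rw [e2, zero_div, zero_smul, zero_add] at e
  set s := planeDet (u - o) (x - u) / planeDet (u - o) (v - u)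
  have hs0 : 0 ≤ s := by
    refine div_nonneg ?_ t1.le
    simp only [planeDet, PiLp.sub_apply] at *; linarith
  have ex : x = u + s • (v - u) := by rw [← e]; abel
  have hs1 : s ≤ 1 := by
    have : planeDet (w - v) (x - v) = (1 - s) * planeDet (v - u) (w - v) := by
      rw [ex]; simp [planeDet]; ring
    rw [this] at x3
    by_contra hc
    have := mul_neg_of_neg_of_pos (show 1 - s < 0 by linarith) t2
    linarith
  refine ⟨1 - s, s, by linarith, hs0, by ring, ?_⟩
  rw [ex, smul_sub, sub_smul, one_smul]; abel

/-- A point where every `sideFun` is positive is interior by continuity; a point on a side leaves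
the polygon as soon as it moves along the right-hand normal of that side. -/
theorem IsConvexNGon.frontier_eq (hp : IsConvexNGon p) :
    frontier (polyHull p) = ⋃ i, segment ℝ (p i) (p (finRotate n i)) := by
  have hc := (polyHull_isCompact p).isClosed
  ext x
  rw [hc.frontier_eq, Set.mem_iUnion]
  constructor
  · rintro ⟨hx, hni⟩
    by_contra hcon
    push Not at hcon
    apply hni
    have hpos : ∀ i, 0 < sideFun p i x := fun i =>
      lt_of_le_of_ne ((hp.mem_polyHull_iff x).1 hx i) fun h => hcon i (hp.mem_segment hx h.symm)
    rw [mem_interior_iff_mem_nhds]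
    have : ∀ᶠ y in nhds x, ∀ i, 0 < sideFun p i y :=
      Filter.eventually_all.2 fun i =>
        (sideFun_continuous p i).continuousAt.eventually (lt_mem_nhds (hpos i))
    filter_upwards [this] with y hy
    exact (hp.mem_polyHull_iff y).2 fun i => (hy i).le
  · rintro ⟨i, hi⟩
    have hxK : x ∈ polyHull p :=
      (polyHull_convex p).segment_subset (vertex_mem_polyHull p _) (vertex_mem_polyHull p _) hi
    refine ⟨hxK, fun hint => ?_⟩
    have hz : sideFun p i x = 0 := by
      obtain ⟨s, t, -, -, hst, rfl⟩ := hi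
      rw [sideFun_lin p i s t hst, sideFun_left, sideFun_right]; ring
    set d := p (finRotate n i) - p i with hd
    let q : ℝ → Plane := fun t => x + t • !₂[d 1, - d 0]
    have hq : Continuous q := by fun_prop
    have hev : ∀ᶠ t in nhds (0 : ℝ), q t ∈ polyHull p := by
      apply hq.continuousAt.eventually
      simpa [q] using mem_interior_iff_mem_nhds.1 hint
    obtain ⟨t, ht, ht0⟩ := ((hev.filter_mono nhdsWithin_le_nhds).and
      (self_mem_nhdsWithin (a := (0 : ℝ)) (s := Set.Ioi 0))).exists
    have := (hp.mem_polyHull_iff _).1 ht i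
    have h2 : sideFun p i (q t) = sideFun p i x - t * ‖d‖ ^ 2 := by
      rw [plane_norm_sq]; simp [sideFun, planeDet, q, hd]; ring
    have h3 : 0 < ‖d‖ := norm_pos_iff.2 (hp.side_ne i)
    have : 0 < t * ‖d‖ ^ 2 := mul_pos ht0 (by positivity)
    linarith

/-- `sideFun p k` is nonnegative at both ends of side `i`. If it vanishes strictly between them it
vanishes at both, which the strict inequalities of `IsConvexNGon` forbid. -/
theorem IsConvexNGon.segment_inter_subset (hp : IsConvexNGon p) {i k : Fin n} (hik : i ≠ k) :
    segment ℝ (p i) (p (finRotate n i)) ∩ segment ℝ (p k) (p (finRotate n k)) ⊆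
      {p i, p (finRotate n i)} := by
  rintro x ⟨⟨s, t, hs, ht, hst, rfl⟩, ⟨s', t', -, -, hst', hx⟩⟩
  have hz : sideFun p k (s • p i + t • p (finRotate n i)) = 0 := by
    rw [← hx, sideFun_lin p k s' t' hst', sideFun_left, sideFun_right]; ring
  rw [sideFun_lin p k s t hst] at hz
  have n1 := hp.sideFun_nonneg k i
  have n2 := hp.sideFun_nonneg k (finRotate n i)
  rcases eq_or_lt_of_le hs with rfl | hs
  · right; simp at hst; simp [hst]
  rcases eq_or_lt_of_le ht with rfl | ht
  · left; simp at hst; simp [hst]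
  exfalso
  have z1 : sideFun p k (p i) = 0 := by nlinarith [mul_nonneg hs.le n1, mul_nonneg ht.le n2]
  have z2 : sideFun p k (p (finRotate n i)) = 0 := by
    nlinarith [mul_nonneg hs.le n1, mul_nonneg ht.le n2]
  have e1 : i = finRotate n k := by
    by_contra h
    exact (hp.sideFun_pos hik h).ne' z1
  by_cases h : finRotate n i = k
  · rw [e1] at h; exact finRotate_finRotate_ne_self hp.1 k h
  · refine (hp.sideFun_pos h ?_).ne' z2
    exact fun h => hik ((finRotate n).injective h)

/-- The perimeter of a convex polygon is the sum of the lengths of its sides. -/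
theorem IsConvexNGon.perimeter_eq (hp : IsConvexNGon p) :
    perimeter (polyHull p) = ∑ i, sideLength p i := by
  have hm : ∀ i, MeasurableSet (segment ℝ (p i) (p (finRotate n i))) := fun i => by
    rw [← convexHull_pair]
    exact ((Set.toFinite _).isCompact_convexHull ℝ).isClosed.measurableSet
  rw [perimeter, hp.frontier_eq, measure_iUnion₀ _ fun i => (hm i).nullMeasurableSet, tsum_fintype,
    ENNReal.toReal_sum]
  · refine Finset.sum_congr rfl fun i _ => ?_
    rw [hausdorffMeasure_segment, sideLength, edist_dist, ENNReal.toReal_ofReal dist_nonneg]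
  · intro i _
    rw [hausdorffMeasure_segment]; exact edist_ne_top _ _
  · intro i k hik
    have := Measure.nullSingletonClass_hausdorff Plane (zero_lt_one (α := ℝ))
    exact measure_mono_null (hp.segment_inter_subset hik) ((Set.toFinite _).measure_zero _)

end ConvexNGon

/-! ### Area of triangles and the shoelace formula. -/

theorem volume_segment_plane (x y : Plane) : volume (segment ℝ x y) = 0 := by
  have hne : line[ℝ, x, y] ≠ ⊤ := by
    intro h
    have h1 := congrArg AffineSubspace.direction h
    rw [direction_affineSpan, vectorSpan_pair_rev, AffineSubspace.direction_top] at h1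
    have h2 := finrank_span_le_card (R := ℝ) ({y -ᵥ x} : Set Plane)
    rw [h1, finrank_top, finrank_euclideanSpace] at h2
    simp at h2
  refine measure_mono_null ?_ (Measure.addHaar_affineSubspace volume _ hne)
  rw [← convexHull_pair]
  exact convexHull_subset_affineSpan _

/-- The triangle with vertices `0`, `u`, `v`. -/
def originTriangle (u v : Plane) : Set Plane :=
  {x | ∃ s t : ℝ, 0 ≤ s ∧ 0 ≤ t ∧ s + t ≤ 1 ∧ s • u + t • v = x}

/-- The standard triangle. -/
def unitTriangle : Set Plane := {x | 0 ≤ x 0 ∧ 0 ≤ x 1 ∧ x 0 + x 1 ≤ 1}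

theorem isClosed_unitTriangle : IsClosed unitTriangle := by
  have h0 : Continuous fun x : Plane => x 0 := by fun_prop
  have h1 : Continuous fun x : Plane => x 1 := by fun_prop
  exact (isClosed_le continuous_const h0).inter
    ((isClosed_le continuous_const h1).inter (isClosed_le (h0.add h1) continuous_const))

theorem volume_unitTriangle : volume unitTriangle = ENNReal.ofReal (1 / 2) := by
  -- Reflection in the centre of the unit square: the triangle and its image cover the square and
  -- overlap only in a diagonal.
  let c : Plane := !₂[1, 1]
  let T' : Set Plane := (fun x => c - x) ⁻¹' unitTriangle
  have hT' : volume T' = volume unitTriangle :=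
    (Measure.measurePreserving_sub_left volume c).measure_preimage
      isClosed_unitTriangle.measurableSet.nullMeasurableSet
  have hT'c : IsClosed T' := isClosed_unitTriangle.preimage (by fun_prop)
  have hunion : unitTriangle ∪ T' =
      (WithLp.ofLp : Plane → Fin 2 → ℝ) ⁻¹' Set.Icc (fun _ => 0) (fun _ => 1) := by
    ext x
    simp only [unitTriangle, T', c, Set.mem_union, Set.mem_preimage, Set.mem_Icc, Pi.le_def,
      Fin.forall_fin_two, Set.mem_ofPred_eq, PiLp.sub_apply, Matrix.cons_val_zero,
      Matrix.cons_val_one]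
    constructor
    · rintro (h | h) <;> refine ⟨⟨?_, ?_⟩, ?_, ?_⟩ <;> linarith
    · rintro ⟨⟨h1, h2⟩, h3, h4⟩
      rcases le_total (x 0 + x 1) 1 with h | h
      · exact Or.inl ⟨h1, h2, h⟩
      · right; refine ⟨?_, ?_, ?_⟩ <;> linarith
  have hvol : volume (unitTriangle ∪ T') = 1 := by
    rw [hunion, (PiLp.volume_preserving_ofLp (Fin 2)).measure_preimage
      measurableSet_Icc.nullMeasurableSet, Real.volume_Icc_pi]
    simp
  have hdisj : AEDisjoint volume unitTriangle T' := by
    refine measure_mono_null ?_ (volume_segment_plane !₂[1, 0] !₂[0, 1])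
    rintro x ⟨⟨h1, h2, h3⟩, h4, h5, h6⟩
    simp only [c, PiLp.sub_apply, Matrix.cons_val_zero, Matrix.cons_val_one] at h4 h5 h6
    refine ⟨x 0, x 1, h1, h2, by linarith, ?_⟩
    apply plane_ext <;> simp
  rw [measure_union₀ hT'c.measurableSet.nullMeasurableSet hdisj, hT', ← two_mul] at hvol
  have : volume unitTriangle = 1 / 2 := by
    rw [ENNReal.eq_div_iff (by simp) (by simp)]; exact hvol
  rw [this, ENNReal.ofReal_div_of_pos (by norm_num)]; simp

/-- The linear map with given columns. -/
noncomputable def columnMap (u v : Plane) : Plane →ₗ[ℝ] Plane where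
  toFun x := x 0 • u + x 1 • v
  map_add' x y := by simp only [PiLp.add_apply]; module
  map_smul' r x := by simp only [PiLp.smul_apply, smul_eq_mul, RingHom.id_apply]; module

theorem det_columnMap (u v : Plane) : LinearMap.det (columnMap u v) = planeDet u v := by
  rw [← LinearMap.det_toMatrix (EuclideanSpace.basisFun (Fin 2) ℝ).toBasis, Matrix.det_fin_two]
  simp [LinearMap.toMatrix_apply, columnMap, planeDet]
  ring

theorem originTriangle_eq (u v : Plane) :
    originTriangle u v = columnMap u v '' unitTriangle := by
  ext x
  constructor
  · rintro ⟨s, t, hs, ht, hst, rfl⟩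
    exact ⟨!₂[s, t], ⟨by simpa, by simpa, by simpa⟩, by simp [columnMap]⟩
  · rintro ⟨y, ⟨h1, h2, h3⟩, rfl⟩
    exact ⟨y 0, y 1, h1, h2, h3, rfl⟩

theorem isClosed_originTriangle (u v : Plane) : IsClosed (originTriangle u v) := by
  have : originTriangle u v = convexHull ℝ {0, u, v} := by
    ext x
    rw [convexHull_insert (by simp), convexHull_pair]
    simp only [convexJoin, Set.mem_iUnion, Set.mem_singleton_iff, exists_prop, exists_eq_left]
    constructor
    · rintro ⟨s, t, hs, ht, hst, rfl⟩
      rcases eq_or_lt_of_le (add_nonneg hs ht) with h | h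
      · obtain rfl : s = 0 := by linarith
        obtain rfl : t = 0 := by linarith
        refine ⟨u, left_mem_segment _ _ _, ?_⟩
        simpa using left_mem_segment ℝ (0 : Plane) u
      · refine ⟨(s / (s + t)) • u + (t / (s + t)) • v,
          ⟨_, _, by positivity, by positivity, by field_simp, rfl⟩,
          1 - (s + t), s + t, by linarith, h.le, by ring, ?_⟩
        rw [smul_zero, zero_add, smul_add, smul_smul, smul_smul, mul_div_cancel₀ _ h.ne',
          mul_div_cancel₀ _ h.ne']
    · rintro ⟨y, ⟨s, t, hs, ht, hst, rfl⟩, c, d, hc, hd, hcd, rfl⟩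
      refine ⟨d * s, d * t, by positivity, by positivity, ?_, ?_⟩
      · rw [← mul_add, hst]; linarith
      · simp only [smul_zero, zero_add, smul_add, smul_smul]
  rw [this]
  exact ((Set.toFinite _).isCompact_convexHull ℝ).isClosed

theorem volume_originTriangle (u v : Plane) :
    volume (originTriangle u v) = ENNReal.ofReal (|planeDet u v| / 2) := by
  rw [originTriangle_eq, Measure.addHaar_image_linearMap, det_columnMap, volume_unitTriangle,
    ← ENNReal.ofReal_mul (abs_nonneg _)]
  congr 1; ring

section ConvexNGon

variable {n : ℕ} {p : Polygon Plane n}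

theorem IsConvexNGon.polyHull_mem_nhds_zero (hp : IsConvexNGon p)
    (h0 : ∀ i, 0 < planeDet (p i) (p (finRotate n i))) : polyHull p ∈ nhds (0 : Plane) := by
  have : ∀ᶠ y in nhds (0 : Plane), ∀ i, 0 < sideFun p i y :=
    Filter.eventually_all.2 fun i =>
      (sideFun_continuous p i).continuousAt.eventually (lt_mem_nhds (by
        rw [sideFun_zero]; exact h0 i))
  filter_upwards [this] with y hy
  exact (hp.mem_polyHull_iff y).2 fun i => (hy i).le

/-- Dividing a nonzero point by its gauge puts it on the frontier, hence on some side; the triangle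
over that side contains the point. -/
theorem IsConvexNGon.polyHull_eq_iUnion (hp : IsConvexNGon p)
    (h0 : ∀ i, 0 < planeDet (p i) (p (finRotate n i))) :
    polyHull p = ⋃ i, originTriangle (p i) (p (finRotate n i)) := by
  have hn := hp.polyHull_mem_nhds_zero h0
  have hc := polyHull_convex p
  ext x
  rw [Set.mem_iUnion]
  constructor
  · intro hx
    by_cases hx0 : x = 0
    · exact ⟨⟨0, by have := hp.1; omega⟩, 0, 0, le_rfl, le_rfl, by norm_num, by simp [hx0]⟩
    have hg : 0 < gauge (polyHull p) x :=
      (gauge_pos (absorbent_nhds_zero hn)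
        ((NormedSpace.isVonNBounded_iff ℝ).2 (polyHull_isCompact p).isBounded)).2 hx0
    have hg1 : gauge (polyHull p) x ≤ 1 := gauge_le_one_of_mem hx
    set g := gauge (polyHull p) x
    have hf : g⁻¹ • x ∈ frontier (polyHull p) := by
      rw [← gauge_eq_one_iff_mem_frontier hc hn, gauge_smul_of_nonneg (by positivity),
        smul_eq_mul]
      exact inv_mul_cancel₀ hg.ne'
    rw [hp.frontier_eq, Set.mem_iUnion] at hf
    obtain ⟨i, s, t, hs, ht, hst, he⟩ := hf
    refine ⟨i, g * s, g * t, by positivity, by positivity, by rw [← mul_add, hst]; linarith, ?_⟩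
    rw [← smul_smul, ← smul_smul, ← smul_add, he, smul_smul, mul_inv_cancel₀ hg.ne', one_smul]
  · rintro ⟨i, s, t, hs, ht, hst, rfl⟩
    have := hc.sum_mem (t := (Finset.univ : Finset (Fin 3))) (w := ![1 - (s + t), s, t])
      (z := ![0, p i, p (finRotate n i)])
      (by intro i _; fin_cases i <;> simp <;> linarith) (by simp [Fin.sum_univ_three]; ring)
      (by
        intro k _
        fin_cases k
        · exact mem_of_mem_nhds hn
        · exact vertex_mem_polyHull p i
        · exact vertex_mem_polyHull p _)
    simpa [Fin.sum_univ_three, -finRotate_apply] using this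

/-- The gauge of a point of such a triangle is the sum of its two coefficients. A nonzero common
point thus has the same radial projection in both triangles, and this projection lies on two sides,
hence is a vertex. -/
theorem IsConvexNGon.originTriangle_inter_subset (hp : IsConvexNGon p)
    (h0 : ∀ i, 0 < planeDet (p i) (p (finRotate n i))) {i k : Fin n} (hik : i ≠ k) :
    originTriangle (p i) (p (finRotate n i)) ∩ originTriangle (p k) (p (finRotate n k)) ⊆
      segment ℝ 0 (p i) ∪ segment ℝ 0 (p (finRotate n i)) := by
  have hn := hp.polyHull_mem_nhds_zero h0
  have hc := polyHull_convex p
  have key : ∀ (j : Fin n) (s t : ℝ), 0 ≤ s → 0 ≤ t → 0 < s + t →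
      ∃ y ∈ segment ℝ (p j) (p (finRotate n j)),
        s • p j + t • p (finRotate n j) = (s + t) • y := by
    intro j s t hs ht hst
    refine ⟨(s / (s + t)) • p j + (t / (s + t)) • p (finRotate n j),
      ⟨_, _, by positivity, by positivity, by field_simp, rfl⟩, ?_⟩
    rw [smul_add, smul_smul, smul_smul, mul_div_cancel₀ _ hst.ne', mul_div_cancel₀ _ hst.ne']
  have hgauge : ∀ (j : Fin n) (y : Plane), y ∈ segment ℝ (p j) (p (finRotate n j)) →
      gauge (polyHull p) y = 1 := by
    intro j y hy
    rw [gauge_eq_one_iff_mem_frontier hc hn, hp.frontier_eq]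
    exact Set.mem_iUnion.2 ⟨j, hy⟩
  rintro x ⟨⟨s, t, hs, ht, hst, hx⟩, s', t', hs', ht', hst', hx'⟩
  rcases eq_or_lt_of_le (add_nonneg hs ht) with h | h
  · obtain rfl : s = 0 := by linarith
    obtain rfl : t = 0 := by linarith
    left; rw [← hx]; simpa using left_mem_segment ℝ (0 : Plane) (p i)
  rcases eq_or_lt_of_le (add_nonneg hs' ht') with h' | h'
  · obtain rfl : s' = 0 := by linarith
    obtain rfl : t' = 0 := by linarith
    left; rw [← hx']; simpa using left_mem_segment ℝ (0 : Plane) (p i)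
  obtain ⟨y, hy, e⟩ := key i s t hs ht h
  obtain ⟨y', hy', e'⟩ := key k s' t' hs' ht' h'
  have g1 : gauge (polyHull p) x = s + t := by
    rw [← hx, e, gauge_smul_of_nonneg h.le, hgauge i y hy, smul_eq_mul, mul_one]
  have g2 : gauge (polyHull p) x = s' + t' := by
    rw [← hx', e', gauge_smul_of_nonneg h'.le, hgauge k y' hy', smul_eq_mul, mul_one]
  have hyy : y = y' := by
    have : (s + t) • y = (s + t) • y' := by rw [← e, hx, ← hx', e', ← g1, g2]
    exact smul_right_injective _ h.ne' this
  subst hyy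
  rw [← hx, e]
  rcases hp.segment_inter_subset hik ⟨hy, hy'⟩ with rfl | h2
  · left; exact ⟨1 - (s + t), s + t, by linarith, h.le, by ring, by simp⟩
  · right
    rw [Set.mem_singleton_iff] at h2
    exact ⟨1 - (s + t), s + t, by linarith, h.le, by ring, by rw [h2, smul_zero, zero_add]⟩

/-- The shoelace formula. -/
theorem IsConvexNGon.area_eq (hp : IsConvexNGon p)
    (h0 : ∀ i, 0 < planeDet (p i) (p (finRotate n i))) :
    area (polyHull p) = ∑ i, planeDet (p i) (p (finRotate n i)) / 2 := by
  rw [area, hp.polyHull_eq_iUnion h0, measure_iUnion₀ _ fun i =>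
    (isClosed_originTriangle _ _).measurableSet.nullMeasurableSet, tsum_fintype,
    ENNReal.toReal_sum]
  · refine Finset.sum_congr rfl fun i _ => ?_
    rw [volume_originTriangle, abs_of_pos (h0 i), ENNReal.toReal_ofReal (by linarith [h0 i])]
  · intro i _
    rw [volume_originTriangle]; exact ENNReal.ofReal_ne_top
  · intro i k hik
    exact measure_mono_null (hp.originTriangle_inter_subset h0 hik)
      (measure_union_null (volume_segment_plane _ _) (volume_segment_plane _ _))

end ConvexNGon

/-! ### Admissible polygons and the functional on them. -/

theorem abs_planeDet_le (u v : Plane) : |planeDet u v| ≤ ‖u‖ * ‖v‖ := by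
  apply abs_le_of_sq_le_sq _ (by positivity)
  rw [mul_pow, plane_norm_sq, plane_norm_sq, planeDet]
  nlinarith [sq_nonneg (u 0 * v 0 + u 1 * v 1)]

theorem sideLength_eq_norm {n : ℕ} (p : Polygon Plane n) (i : Fin n) :
    sideLength p i = ‖p (finRotate n i) - p i‖ := by
  rw [sideLength, dist_comm, dist_eq_norm]

/-- A convex polygon with vertices in the disk of radius `b` and containing the disk of
radius `a`; the latter condition is expressed by the distances of the sides to the origin. -/
structure IsAdmissible (a b : ℝ) {n : ℕ} (p : Polygon Plane n) : Prop where
  convex : IsConvexNGon p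
  norm_le : ∀ i, ‖p i‖ ≤ b
  le_det : ∀ i, a * ‖p (finRotate n i) - p i‖ ≤ planeDet (p i) (p (finRotate n i))

/-- The contribution of a side to the functional. -/
noncomputable def sideJ (lam : ℝ) (u v : Plane) : ℝ := lam / 2 * planeDet u v - ‖v - u‖

/-- The functional on polygons. -/
noncomputable def polyJ (lam : ℝ) {n : ℕ} (p : Polygon Plane n) : ℝ :=
  ∑ i, sideJ lam (p i) (p (finRotate n i))

/-- A polygon that minimizes the functional among all admissible polygons. -/
def IsOptimalPolygon (a b lam : ℝ) {n : ℕ} (p : Polygon Plane n) : Prop :=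
  IsAdmissible a b p ∧ ∀ (m : ℕ) (q : Polygon Plane m), IsAdmissible a b q →
    polyJ lam p ≤ polyJ lam q

section

variable {a b lam : ℝ} {n : ℕ} {p : Polygon Plane n}

theorem IsAdmissible.det_pos (hp : IsAdmissible a b p) (ha : 0 < a) (i : Fin n) :
    0 < planeDet (p i) (p (finRotate n i)) :=
  lt_of_lt_of_le (mul_pos ha (norm_pos_iff.2 (hp.convex.side_ne i))) (hp.le_det i)

theorem IsAdmissible.functionalJ_eq (hp : IsAdmissible a b p) (ha : 0 < a) :
    functionalJ lam (polyHull p) = polyJ lam p := by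
  rw [functionalJ, hp.convex.area_eq (hp.det_pos ha), hp.convex.perimeter_eq, polyJ,
    Finset.mul_sum, ← Finset.sum_sub_distrib]
  refine Finset.sum_congr rfl fun i _ => ?_
  rw [sideJ, sideLength_eq_norm]; ring

theorem IsAdmissible.mem_class (hp : IsAdmissible a b p) :
    polyHull p ∈ annularConvexClass a b := by
  refine ⟨polyHull_convex p, fun x hx => ?_, ?_⟩
  · rw [hp.convex.mem_polyHull_iff]
    intro i
    rw [mem_closedBall_zero_iff] at hx
    have h1 : sideFun p i x = planeDet (p i) (p (finRotate n i)) +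
        planeDet (p (finRotate n i) - p i) x := by
      simp [sideFun, planeDet]; ring
    have h2 := (abs_le.1 (abs_planeDet_le (p (finRotate n i) - p i) x)).1
    have h3 := hp.le_det i
    have h4 := mul_le_mul_of_nonneg_left hx (norm_nonneg (p (finRotate n i) - p i))
    rw [h1]; linarith
  · refine convexHull_min ?_ (convex_closedBall _ _)
    rintro _ ⟨i, rfl⟩
    rw [mem_closedBall_zero_iff]
    exact hp.norm_le i

theorem IsConvexNGon.isAdmissible (hp : IsConvexNGon p) (ha : 0 < a)
    (h : polyHull p ∈ annularConvexClass a b) : IsAdmissible a b p := by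
  refine ⟨hp, fun i => ?_, fun i => ?_⟩
  · rw [← mem_closedBall_zero_iff]
    exact h.2.2 (vertex_mem_polyHull p i)
  · set d := p (finRotate n i) - p i with hd
    have hd0 : 0 < ‖d‖ := norm_pos_iff.2 (hp.side_ne i)
    have hy : ‖(!₂[d 1, -d 0] : Plane)‖ = ‖d‖ := by
      rw [← sq_eq_sq₀ (norm_nonneg _) (norm_nonneg _), plane_norm_sq, plane_norm_sq]
      simp; ring
    -- This is the point of the inner circle in the direction of the outer normal of the side, the
    -- extreme test for the half-plane.
    have hmem : (a / ‖d‖) • !₂[d 1, -d 0] ∈ polyHull p := by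
      apply h.2.1
      rw [mem_closedBall_zero_iff, norm_smul, hy, Real.norm_eq_abs, abs_of_pos (by positivity)]
      field_simp; exact le_rfl
    have := (hp.mem_polyHull_iff _).1 hmem i
    have e : sideFun p i ((a / ‖d‖) • !₂[d 1, -d 0]) =
        planeDet (p i) (p (finRotate n i)) - a / ‖d‖ * ‖d‖ ^ 2 := by
      rw [plane_norm_sq]; simp [sideFun, planeDet, hd]; ring
    have e2 : a / ‖d‖ * ‖d‖ ^ 2 = a * ‖d‖ := by field_simp
    rw [e, e2] at this
    linarith

theorem IsOptimalSet.isOptimalPolygon (ha : 0 < a) (hp : IsConvexNGon p)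
    (h : IsOptimalSet a b lam (polyHull p)) : IsOptimalPolygon a b lam p := by
  have hadm := hp.isAdmissible ha h.1
  refine ⟨hadm, fun m q hq => ?_⟩
  rw [← hadm.functionalJ_eq ha, ← hq.functionalJ_eq ha]
  exact h.2 hq.mem_class

theorem polyJ_sub_eq_sum (p q : Polygon Plane n) (S : Finset (Fin n))
    (h : ∀ k ∉ S, q k = p k ∧ q (finRotate n k) = p (finRotate n k)) :
    polyJ lam q - polyJ lam p = ∑ k ∈ S, (sideJ lam (q k) (q (finRotate n k)) -
      sideJ lam (p k) (p (finRotate n k))) := by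
  rw [polyJ, polyJ, ← Finset.sum_sub_distrib]
  symm
  apply Finset.sum_subset (Finset.subset_univ S)
  intro k _ hk
  rw [(h k hk).1, (h k hk).2, sub_self]

/-- Convexity is a finite system of strict inequalities, hence an open condition on the vertices. -/
theorem eventually_isConvexNGon {q : ℝ → Polygon Plane n} (h0 : IsConvexNGon (q 0))
    (hc : ∀ k, Continuous fun t => q t k) : ∀ᶠ t in nhds (0 : ℝ), IsConvexNGon (q t) := by
  have : ∀ᶠ t in nhds (0 : ℝ), ∀ i k : Fin n, k ≠ i → k ≠ finRotate n i →
      0 < planeDet (q t (finRotate n i) - q t i) (q t k - q t i) := by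
    refine Filter.eventually_all.2 fun i => Filter.eventually_all.2 fun k => ?_
    by_cases h1 : k = i
    · simp [h1]
    by_cases h2 : k = finRotate n i
    · rw [h2]; simp
    have hcont : Continuous fun t => planeDet (q t (finRotate n i) - q t i) (q t k - q t i) :=
      planeDet.continuous.comp (((hc _).sub (hc _)).prodMk ((hc _).sub (hc _)))
    filter_upwards [hcont.continuousAt.eventually (lt_mem_nhds (h0.2 i k h1 h2))] with t ht _ _
    exact ht
  filter_upwards [this] with t ht
  exact ⟨h0.1, ht⟩

/-- The polygon with the vertex `i` moved to `v`. -/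
def moveVertex (p : Polygon Plane n) (i : Fin n) (v : Plane) : Polygon Plane n :=
  ⟨Function.update p.vertices i v⟩

@[simp] theorem moveVertex_self (p : Polygon Plane n) (i : Fin n) (v : Plane) :
    moveVertex p i v i = v := Function.update_self _ _ _

theorem moveVertex_ne (p : Polygon Plane n) {i k : Fin n} (h : k ≠ i) (v : Plane) :
    moveVertex p i v k = p k := Function.update_of_ne h _ _

theorem moveVertex_eq_self (p : Polygon Plane n) (i : Fin n) : moveVertex p i (p i) = p := by
  simp [moveVertex]

theorem continuous_moveVertex {p : ℝ → Polygon Plane n} (hp : ∀ k, Continuous fun t => p t k)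
    (i : Fin n) {v : ℝ → Plane} (hv : Continuous v) (k : Fin n) :
    Continuous fun t => moveVertex (p t) i (v t) k := by
  by_cases h : k = i
  · subst h; simpa using hv
  · simpa [moveVertex_ne _ h] using hp k

theorem polyJ_moveVertex (hn : 2 ≤ n) (p : Polygon Plane n) (h : Fin n) (v : Plane) :
    polyJ lam (moveVertex p (finRotate n h) v) - polyJ lam p =
      (sideJ lam (p h) v + sideJ lam v (p (finRotate n (finRotate n h)))) -
      (sideJ lam (p h) (p (finRotate n h)) +
        sideJ lam (p (finRotate n h)) (p (finRotate n (finRotate n h)))) := by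
  have h1 := finRotate_ne_self hn h
  have h2 := finRotate_ne_self hn (finRotate n h)
  rw [polyJ_sub_eq_sum _ _ {h, finRotate n h}, Finset.sum_pair h1.symm, moveVertex_self,
    moveVertex_ne _ h1.symm, moveVertex_ne _ h2]
  · ring
  · intro k hk
    simp only [Finset.mem_insert, Finset.mem_singleton, not_or] at hk
    exact ⟨moveVertex_ne _ hk.2 _, moveVertex_ne _ (fun e => hk.1 ((finRotate n).injective e)) _⟩

theorem IsAdmissible.moveVertex (hp : IsAdmissible a b p) (h : Fin n) {v : Plane}
    (hc : IsConvexNGon (moveVertex p (finRotate n h) v)) (hv : ‖v‖ ≤ b)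
    (h1 : a * ‖v - p h‖ ≤ planeDet (p h) v)
    (h2 : a * ‖p (finRotate n (finRotate n h)) - v‖ ≤
      planeDet v (p (finRotate n (finRotate n h)))) :
    IsAdmissible a b (moveVertex p (finRotate n h) v) := by
  have hn := hp.convex.1
  have n1 := finRotate_ne_self (show 2 ≤ n by omega) h
  have n2 := finRotate_ne_self (show 2 ≤ n by omega) (finRotate n h)
  refine ⟨hc, fun i => ?_, fun i => ?_⟩
  · by_cases hi : i = finRotate n h
    · rw [hi, moveVertex_self]; exact hv
    · rw [moveVertex_ne _ hi]; exact hp.norm_le i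
  · by_cases hi : i = finRotate n h
    · rw [hi, moveVertex_self, moveVertex_ne _ n2]; exact h2
    by_cases hi' : i = h
    · rw [hi', moveVertex_self, moveVertex_ne _ n1.symm]; exact h1
    rw [moveVertex_ne _ hi, moveVertex_ne _ fun e => hi' ((finRotate n).injective e)]
    exact hp.le_det i

/-! ### Variation of a single vertex: tangency at vertices in the open disk. -/

theorem planeDet_eq_zero_of_sameRay {u v : Plane} (h : SameRay ℝ u v) : planeDet u v = 0 := by
  rcases h with rfl | rfl | ⟨r, s, hr, hs, e⟩
  · simp
  · simp
  · have : r * planeDet u v = 0 := by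
      rw [← planeDet.smul_left, e, planeDet.smul_left, planeDet.self, mul_zero]
    exact (mul_eq_zero.1 this).resolve_left hr.ne'

theorem two_mul_norm_le (y d : Plane) : 2 * ‖y‖ ≤ ‖y + d‖ + ‖y - d‖ := by
  have : (2 : ℝ) • y = (y + d) + (y - d) := by module
  calc 2 * ‖y‖ = ‖(2 : ℝ) • y‖ := by rw [norm_smul]; simp
    _ ≤ _ := by rw [this]; exact norm_add_le _ _

theorem two_mul_norm_lt {y d : Plane} (h : planeDet y d ≠ 0) :
    2 * ‖y‖ < ‖y + d‖ + ‖y - d‖ := by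
  have : (2 : ℝ) • y = (y + d) + (y - d) := by module
  calc 2 * ‖y‖ = ‖(2 : ℝ) • y‖ := by rw [norm_smul]; simp
    _ < _ := by
      rw [this]
      apply norm_add_lt_of_not_sameRay
      intro hs
      apply h
      have := planeDet_eq_zero_of_sameRay hs
      simp only [planeDet, PiLp.add_apply, PiLp.sub_apply] at *
      linarith

/-- In an optimal polygon, no vertex in the open disk can be moved freely along a line. -/
theorem IsOptimalPolygon.not_free (hp : IsOptimalPolygon a b lam p) (h : Fin n) (d : Plane)
    (hb : ‖p (finRotate n h)‖ < b)
    (hfree : ∀ᶠ t in nhds (0 : ℝ),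
      a * ‖p (finRotate n h) + t • d - p h‖ ≤ planeDet (p h) (p (finRotate n h) + t • d) ∧
      a * ‖p (finRotate n (finRotate n h)) - (p (finRotate n h) + t • d)‖ ≤
        planeDet (p (finRotate n h) + t • d) (p (finRotate n (finRotate n h))))
    (hd : planeDet (p (finRotate n h) - p h) d ≠ 0 ∨
      planeDet (p (finRotate n (finRotate n h)) - p (finRotate n h)) d ≠ 0) : False := by
  have hn := hp.1.convex.1
  set u := p h
  set v := p (finRotate n h) with hv
  set w := p (finRotate n (finRotate n h))
  let q : ℝ → Polygon Plane n := fun t => moveVertex p (finRotate n h) (v + t • d)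
  have hq0 : q 0 = p := by simp only [q, zero_smul, add_zero, hv]; exact moveVertex_eq_self _ _
  have hcont : Continuous fun t : ℝ => v + t • d := by fun_prop
  have hadm : ∀ᶠ t in nhds (0 : ℝ), IsAdmissible a b (q t) := by
    have e1 : ∀ᶠ t in nhds (0 : ℝ), IsConvexNGon (q t) :=
      eventually_isConvexNGon (by rw [hq0]; exact hp.1.convex)
        (continuous_moveVertex (fun _ => continuous_const) _ hcont)
    have e2 : ∀ᶠ t in nhds (0 : ℝ), ‖v + t • d‖ < b :=
      hcont.norm.continuousAt.eventually (gt_mem_nhds (by simpa using hb))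
    filter_upwards [e1, e2, hfree] with t h1 h2 h3
    exact hp.1.moveVertex h h1 h2.le h3.1 h3.2
  have hneg : ∀ᶠ t in nhds (0 : ℝ), IsAdmissible a b (q (-t)) :=
    (continuous_neg.tendsto' (0 : ℝ) 0 neg_zero).eventually hadm
  obtain ⟨t, ⟨h1, h2⟩, ht⟩ := (((hadm.and hneg).filter_mono nhdsWithin_le_nhds).and
    (self_mem_nhdsWithin (a := (0 : ℝ)) (s := Set.Ioi 0))).exists
  have m1 := hp.2 n _ h1
  have m2 := hp.2 n _ h2
  have j1 := polyJ_moveVertex (lam := lam) (by omega) p h (v + t • d)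
  have j2 := polyJ_moveVertex (lam := lam) (by omega) p h (v + (-t) • d)
  change polyJ lam (q t) - _ = _ at j1
  change polyJ lam (q (-t)) - _ = _ at j2
  simp only [sideJ, planeDet.add_left, planeDet.add_right, planeDet.smul_left,
    planeDet.smul_right] at j1 j2
  have r1 : v + t • d - u = (v - u) + t • d := by abel
  have r2 : v + (-t) • d - u = (v - u) - t • d := by module
  have r3 : w - (v + t • d) = (w - v) - t • d := by abel
  have r4 : w - (v + (-t) • d) = (w - v) + t • d := by module
  rw [r1, r3] at j1
  rw [r2, r4] at j2
  -- The determinants are affine in `t`, so they cancel in the sum over `t` and `-t`. Only the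
  -- convexity of the norms remains, and it is strict on a side not parallel to `d`.
  have k1 := two_mul_norm_le (v - u) (t • d)
  have k2 := two_mul_norm_le (w - v) (t • d)
  have ht' : t ≠ 0 := ht.ne'
  rcases hd with hd | hd
  · have := two_mul_norm_lt (y := v - u) (d := t • d)
      (by rw [planeDet.smul_right]; exact mul_ne_zero ht' hd)
    linarith
  · have := two_mul_norm_lt (y := w - v) (d := t • d)
      (by rw [planeDet.smul_right]; exact mul_ne_zero ht' hd)
    linarith

/-- The side following a vertex in the open disk is tangent to the small disk. -/
theorem IsOptimalPolygon.tangent_next (hp : IsOptimalPolygon a b lam p) (h : Fin n)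
    (hb : ‖p (finRotate n h)‖ < b) :
    planeDet (p (finRotate n h)) (p (finRotate n (finRotate n h))) =
      a * ‖p (finRotate n (finRotate n h)) - p (finRotate n h)‖ := by
  refine le_antisymm (not_lt.1 fun hlt => ?_) (hp.1.le_det _)
  have l1 := hp.1.le_det h
  have hturn := hp.1.convex.turn_pos h
  -- Sliding the vertex along the line of the previous side scales both members of that side's
  -- constraint equally; the assumed slack absorbs the change in the next side.
  apply hp.not_free h (p (finRotate n h) - p h) hb
  · set u := p h
    set v := p (finRotate n h) with hv
    set w := p (finRotate n (finRotate n h))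
    have c1 : Continuous fun t : ℝ => a * ‖w - (v + t • (v - u))‖ := by fun_prop
    have c2 : Continuous fun t : ℝ => planeDet (v + t • (v - u)) w :=
      planeDet.continuous.comp (f := fun t : ℝ => (v + t • (v - u), w)) (by fun_prop)
    have e1 := (c1.continuousAt (x := 0)).eventually_lt c2.continuousAt (by simpa using hlt)
    filter_upwards [e1, lt_mem_nhds (show (-1 : ℝ) < 0 by norm_num)] with t ht1 ht2
    refine ⟨?_, ht1.le⟩
    have r1 : v + t • (v - u) - u = (1 + t) • (v - u) := by module
    have r2 : planeDet u (v + t • (v - u)) = (1 + t) * planeDet u v := by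
      simp only [planeDet.add_right, planeDet.smul_right, planeDet.sub_right, planeDet.self]; ring
    rw [r1, r2, norm_smul, Real.norm_eq_abs, abs_of_pos (by linarith)]
    nlinarith
  · right
    rw [planeDet.swap]
    exact neg_ne_zero.2 hturn.ne'

/-- The side preceding a vertex in the open disk is tangent to the small disk. -/
theorem IsOptimalPolygon.tangent_prev (hp : IsOptimalPolygon a b lam p) (h : Fin n)
    (hb : ‖p (finRotate n h)‖ < b) :
    planeDet (p h) (p (finRotate n h)) = a * ‖p (finRotate n h) - p h‖ := by
  refine le_antisymm (not_lt.1 fun hlt => ?_) (hp.1.le_det _)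
  have l1 := hp.1.le_det (finRotate n h)
  have hturn := hp.1.convex.turn_pos h
  apply hp.not_free h (p (finRotate n (finRotate n h)) - p (finRotate n h)) hb
  · set u := p h
    set v := p (finRotate n h) with hv
    set w := p (finRotate n (finRotate n h))
    have c1 : Continuous fun t : ℝ => a * ‖v + t • (w - v) - u‖ := by fun_prop
    have c2 : Continuous fun t : ℝ => planeDet u (v + t • (w - v)) :=
      planeDet.continuous.comp (f := fun t : ℝ => (u, v + t • (w - v))) (by fun_prop)
    have e1 := (c1.continuousAt (x := 0)).eventually_lt c2.continuousAt (by simpa using hlt)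
    filter_upwards [e1, gt_mem_nhds (show (0 : ℝ) < 1 by norm_num)] with t ht1 ht2
    refine ⟨ht1.le, ?_⟩
    have r1 : w - (v + t • (w - v)) = (1 - t) • (w - v) := by module
    have r2 : planeDet (v + t • (w - v)) w = (1 - t) * planeDet v w := by
      simp only [planeDet.add_left, planeDet.smul_left, planeDet.sub_left, planeDet.self]; ring
    rw [r1, r2, norm_smul, Real.norm_eq_abs, abs_of_pos (by linarith)]
    nlinarith
  · left
    exact hturn.ne'

end

/-! ### Exclusion of vertices in the open disk. -/

section

variable {a b lam : ℝ} {n : ℕ} {p : Polygon Plane n}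

theorem exists_smul_of_planeDet_eq_zero {y z v : Plane} (hv : planeDet y v ≠ 0)
    (h : planeDet y z = 0) : ∃ μ : ℝ, z = μ • y := by
  have := plane_eq_of_planeDet_ne_zero hv z
  rw [h, zero_div, zero_smul, add_zero] at this
  exact ⟨_, this⟩

theorem eventually_pos_quadratic {c₀ : ℝ} (h : 0 < c₀) (c₁ : ℝ) :
    ∀ᶠ t in nhdsWithin (0 : ℝ) (Set.Ioi 0), 0 < t * (c₀ + c₁ * t) := by
  have hc : Continuous fun t : ℝ => c₀ + c₁ * t := by fun_prop
  have := (hc.continuousAt (x := 0)).eventually (lt_mem_nhds (by simpa using h))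
  filter_upwards [nhdsWithin_le_nhds this, self_mem_nhdsWithin] with t h1 h2
  exact mul_pos h2 h1

/-- Two consecutive vertices of an optimal polygon are not both in the open disk. -/
theorem IsOptimalPolygon.not_both_interior (ha : 0 < a) (hlam : lam * a < 1)
    (hp : IsOptimalPolygon a b lam p) (h : Fin n)
    (hb₁ : ‖p (finRotate n h)‖ < b) (hb₂ : ‖p (finRotate n (finRotate n h))‖ < b) : False := by
  have hn := hp.1.convex.1
  have n1 := finRotate_ne_self (show 2 ≤ n by omega) h
  have n2 := finRotate_ne_self (show 2 ≤ n by omega) (finRotate n h)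
  have n3 := finRotate_ne_self (show 2 ≤ n by omega) (finRotate n (finRotate n h))
  have n4 := finRotate_finRotate_ne_self hn h
  have n5 := finRotate_finRotate_ne_self hn (finRotate n h)
  have t1 := hp.tangent_prev h hb₁
  have t2 := hp.tangent_next h hb₁
  have t3 := hp.tangent_next _ hb₂
  have T1 := hp.1.convex.turn_pos h
  have T2 := hp.1.convex.turn_pos (finRotate n h)
  have hconv := hp.1.convex
  set i₀ := h with hi₀
  set i₁ := finRotate n i₀ with hi₁
  set i₂ := finRotate n i₁ with hi₂
  set i₃ := finRotate n i₂ with hi₃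
  set u := p i₀
  set v := p i₁ with hv
  set w := p i₂ with hw
  set x := p i₃
  -- The normalization gives `d₁` and `d₂` the same component across the side `v w`. The side
  -- therefore moves outward parallel to itself while its ends slide along the lines of the two
  -- neighbouring sides.
  obtain ⟨ρ₁, hρ₁, e₁⟩ : ∃ ρ : ℝ, 0 < ρ ∧ ρ * planeDet (v - u) (w - v) = 1 :=
    ⟨_, inv_pos.2 T1, inv_mul_cancel₀ T1.ne'⟩
  obtain ⟨ρ₂, hρ₂, e₂⟩ : ∃ ρ : ℝ, 0 < ρ ∧ ρ * planeDet (w - v) (x - w) = 1 :=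
    ⟨_, inv_pos.2 T2, inv_mul_cancel₀ T2.ne'⟩
  obtain ⟨d₁, hd₁⟩ : ∃ d, d = ρ₁ • (v - u) := ⟨_, rfl⟩
  obtain ⟨d₂, hd₂⟩ : ∃ d, d = (-ρ₂) • (x - w) := ⟨_, rfl⟩
  have f₁ : planeDet (w - v) d₁ = -1 := by
    rw [hd₁, planeDet.smul_right, planeDet.swap]; linarith
  have f₂ : planeDet (w - v) d₂ = -1 := by
    rw [hd₂, planeDet.smul_right]; linarith
  obtain ⟨μ, hμ⟩ := exists_smul_of_planeDet_eq_zero (z := d₂ - d₁) T2.ne'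
    (by rw [planeDet.sub_right, f₁, f₂, sub_self])
  let q : ℝ → Polygon Plane n := fun t => moveVertex (moveVertex p i₁ (v + t • d₁)) i₂ (w + t • d₂)
  have q₀ : ∀ t, q t i₀ = u := fun t => by
    simp only [q]; rw [moveVertex_ne _ n4.symm, moveVertex_ne _ n1.symm]
  have q₁ : ∀ t, q t i₁ = v + t • d₁ := fun t => by
    simp only [q]; rw [moveVertex_ne _ n2.symm, moveVertex_self]
  have q₂ : ∀ t, q t i₂ = w + t • d₂ := fun t => by simp only [q]; rw [moveVertex_self]
  have q₃ : ∀ t, q t i₃ = x := fun t => by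
    simp only [q]; rw [moveVertex_ne _ n3, moveVertex_ne _ n5]
  have qne : ∀ t k, k ≠ i₁ → k ≠ i₂ → q t k = p k := fun t k h1 h2 => by
    simp only [q]; rw [moveVertex_ne _ h2, moveVertex_ne _ h1]
  have hq0 : q 0 = p := by
    simp only [q, zero_smul, add_zero, hv, hw, moveVertex_eq_self]
  have c1 : Continuous fun t : ℝ => v + t • d₁ := by fun_prop
  have c2 : Continuous fun t : ℝ => w + t • d₂ := by fun_prop
  have E0 : ∀ᶠ t in nhdsWithin (0 : ℝ) (Set.Ioi 0), 0 < t :=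
    eventually_nhdsWithin_of_forall fun _ h => h
  have E1 : ∀ᶠ t in nhds (0 : ℝ), IsConvexNGon (q t) :=
    eventually_isConvexNGon (by rw [hq0]; exact hconv)
      (continuous_moveVertex (continuous_moveVertex (fun _ => continuous_const) _ c1) _ c2)
  have E2 : ∀ᶠ t in nhds (0 : ℝ), ‖v + t • d₁‖ < b :=
    c1.norm.continuousAt.eventually (gt_mem_nhds (by simpa using hb₁))
  have E3 : ∀ᶠ t in nhds (0 : ℝ), ‖w + t • d₂‖ < b :=
    c2.norm.continuousAt.eventually (gt_mem_nhds (by simpa using hb₂))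
  have E4 : ∀ᶠ t in nhds (0 : ℝ), 0 < 1 + t * μ := by
    have hc : Continuous fun t : ℝ => 1 + t * μ := by fun_prop
    exact hc.continuousAt.eventually (lt_mem_nhds (by simp))
  -- `E5` is the gain that keeps the middle side at distance at least `a` from the origin. The
  -- quantity in `E6` is the decrease of the functional: to first order the area grows by `t` and
  -- the perimeter by `t / a`.
  have E5 := eventually_pos_quadratic one_pos (planeDet d₁ d₂)
  have E6 := eventually_pos_quadratic (c₀ := a⁻¹ - lam) (by
    rw [sub_pos, ← one_div, lt_div_iff₀ ha]; exact hlam) (-(lam / 2 * planeDet d₁ d₂))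
  obtain ⟨t, ⟨⟨⟨⟨⟨ht0, h1⟩, h2⟩, h3⟩, h4⟩, h5⟩, h6⟩ :=
    ((((((E0.and
    (nhdsWithin_le_nhds E1)).and (nhdsWithin_le_nhds E2)).and (nhdsWithin_le_nhds E3)).and
    (nhdsWithin_le_nhds E4)).and E5).and E6).exists
  have r1 : v + t • d₁ - u = (1 + t * ρ₁) • (v - u) := by rw [hd₁]; module
  have r3 : x - (w + t • d₂) = (1 + t * ρ₂) • (x - w) := by rw [hd₂]; module
  have r2 : (w + t • d₂) - (v + t • d₁) = (1 + t * μ) • (w - v) := by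
    have : (w + t • d₂) - (v + t • d₁) = (w - v) + t • (d₂ - d₁) := by module
    rw [this, hμ]; module
  have s1 : planeDet u (v + t • d₁) = (1 + t * ρ₁) * planeDet u v := by
    rw [hd₁]; simp only [planeDet, PiLp.add_apply, PiLp.sub_apply, PiLp.smul_apply, smul_eq_mul]
    ring
  have s3 : planeDet (w + t • d₂) x = (1 + t * ρ₂) * planeDet w x := by
    rw [hd₂]; simp only [planeDet, PiLp.add_apply, PiLp.sub_apply, PiLp.smul_apply, smul_eq_mul]
    ring
  have m1 : planeDet v d₂ - planeDet v d₁ = μ * planeDet v w := by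
    rw [← planeDet.sub_right, hμ, planeDet.smul_right, planeDet.sub_right, planeDet.self, sub_zero]
  have m2 : planeDet d₁ w = 1 - planeDet v d₁ := by
    rw [planeDet.swap]; rw [planeDet.sub_left] at f₁; linarith
  have s2 : planeDet (v + t • d₁) (w + t • d₂) =
      (1 + t * μ) * planeDet v w + t * (1 + planeDet d₁ d₂ * t) := by
    simp only [planeDet.add_left, planeDet.add_right, planeDet.smul_left, planeDet.smul_right]
    linear_combination t * m1 + t * m2
  have b1 : 0 < 1 + t * ρ₁ := by positivity
  have b3 : 0 < 1 + t * ρ₂ := by positivity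
  have hadm : IsAdmissible a b (q t) := by
    refine ⟨h1, fun k => ?_, fun k => ?_⟩
    · by_cases hk1 : k = i₁
      · rw [hk1, q₁]; exact h2.le
      by_cases hk2 : k = i₂
      · rw [hk2, q₂]; exact h3.le
      rw [qne t k hk1 hk2]; exact hp.1.norm_le k
    · by_cases hk0 : k = i₀
      · rw [hk0, ← hi₁, q₀, q₁, r1, s1, norm_smul, Real.norm_eq_abs, abs_of_pos b1, t1]
        exact le_of_eq (by ring)
      by_cases hk1 : k = i₁
      · rw [hk1, ← hi₂, q₁, q₂, r2, s2, norm_smul, Real.norm_eq_abs, abs_of_pos h4, t2]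
        have : a * ((1 + t * μ) * ‖w - v‖) = (1 + t * μ) * (a * ‖w - v‖) := by ring
        linarith
      by_cases hk2 : k = i₂
      · rw [hk2, ← hi₃, q₂, q₃, r3, s3, norm_smul, Real.norm_eq_abs, abs_of_pos b3, t3]
        exact le_of_eq (by ring)
      rw [qne t k hk1 hk2, qne t (finRotate n k) (fun e => hk0 ((finRotate n).injective e))
        (fun e => hk1 ((finRotate n).injective e))]
      exact hp.1.le_det k
  have hmin := hp.2 n _ hadm
  have hJ := polyJ_sub_eq_sum (lam := lam) p (q t) {i₀, i₁, i₂} (fun k hk => by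
    simp only [Finset.mem_insert, Finset.mem_singleton, not_or] at hk
    exact ⟨qne t k hk.2.1 hk.2.2, qne t _ (fun e => hk.1 ((finRotate n).injective e))
      (fun e => hk.2.1 ((finRotate n).injective e))⟩)
  rw [Finset.sum_insert (by simp [-finRotate_apply, n1.symm, n4.symm]), Finset.sum_pair n2.symm,
    ← hi₁, ← hi₂, ← hi₃, q₀, q₁, q₂, q₃] at hJ
  simp only [sideJ] at hJ
  rw [r1, r2, r3, s1, s2, s3, norm_smul, norm_smul, norm_smul, Real.norm_eq_abs, Real.norm_eq_abs,
    Real.norm_eq_abs, abs_of_pos b1, abs_of_pos h4, abs_of_pos b3] at hJ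
  have hsum1 : ρ₁ * planeDet u v + μ * planeDet v w + ρ₂ * planeDet w x = 1 := by
    have a1 : ρ₁ * planeDet u v = planeDet v d₁ := by
      rw [hd₁, planeDet.smul_right, planeDet.sub_right, planeDet.self, planeDet.swap u v]; ring
    have a2 : ρ₂ * planeDet w x = - planeDet w d₂ := by
      rw [hd₂, planeDet.smul_right, planeDet.sub_right, planeDet.self]; ring
    rw [planeDet.sub_left] at f₂
    linarith
  -- All three sides are tangent, so each determinant in `hsum1` is `a` times the corresponding
  -- length.
  have hsum2 : ρ₁ * ‖v - u‖ + μ * ‖w - v‖ + ρ₂ * ‖x - w‖ = a⁻¹ := by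
    rw [t1, t2, t3] at hsum1
    apply eq_inv_of_mul_eq_one_left
    linear_combination hsum1
  have : polyJ lam (q t) - polyJ lam p = -(t * (a⁻¹ - lam + -(lam / 2 * planeDet d₁ d₂) * t)) := by
    rw [hJ]
    linear_combination (lam / 2 * t) * hsum1 - t * hsum2
  linarith

/-- In a suitable frame `u = (a, -r)`, `v = (a, s)`, `w = (x, y)`, with `u` and `w` on the same
circle. Tangency of `v w` fixes the scalar product of `v` and `w - v` up to sign, leaving two
directions: the line `u v` itself, excluded by `x < a`, and the second tangent from `v`. Comparing
norms then gives the length `r + s`. -/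
theorem tangent_coords {r s x y L : ℝ} (ha : 0 < a) (hr : 0 < r) (hs : s ^ 2 < r ^ 2) (hL : 0 < L)
    (h1 : (x - a) ^ 2 + (y - s) ^ 2 = L ^ 2) (h2 : x ^ 2 + y ^ 2 = a ^ 2 + r ^ 2)
    (h3 : a * y - s * x = a * L) (h4 : x < a) :
    0 < s ∧ L = r + s ∧ (a ^ 2 + s ^ 2) * (x - a) = -(2 * a * s * L) ∧
      (a ^ 2 + s ^ 2) * (y - s) = (a ^ 2 - s ^ 2) * L := by
  have hg : 0 < a ^ 2 + s ^ 2 := by positivity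
  have hD : (a * (x - a) + s * (y - s) - s * L) * (a * (x - a) + s * (y - s) + s * L) = 0 := by
    have h3' : a * (y - s) - s * (x - a) = a * L := by linarith
    linear_combination (a ^ 2 + s ^ 2) * h1 - (a * (y - s) - s * (x - a) + a * L) * h3'
  rcases mul_eq_zero.1 hD with hD | hD
  · exfalso
    have : (a ^ 2 + s ^ 2) * (x - a) = 0 := by linear_combination a * hD - s * h3
    rcases mul_eq_zero.1 this with h | h <;> linarith
  · have hx : (a ^ 2 + s ^ 2) * (x - a) = -(2 * a * s * L) := by linear_combination a * hD - s * h3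
    have hy : (a ^ 2 + s ^ 2) * (y - s) = (a ^ 2 - s ^ 2) * L := by
      linear_combination s * hD + a * h3
    have hs0 : 0 < s := by
      have : (a ^ 2 + s ^ 2) * (x - a) < 0 := mul_neg_of_pos_of_neg hg (by linarith)
      have h5 : 0 < (a * L) * s := by linarith
      exact pos_of_mul_pos_right h5 (by positivity)
    refine ⟨hs0, ?_, hx, hy⟩
    have hq : (L - s - r) * (L - s + r) = 0 := by linear_combination h2 - h1 - 2 * hD
    have : s < r := lt_of_pow_lt_pow_left₀ 2 hr.le hs
    rcases mul_eq_zero.1 hq with h | h <;> linarith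

set_option maxHeartbeats 1000000 in
/-- Comparison of the two tangent sides `u v`, `v w` with the sides `u m`, `m w`, where `m` is the
second intersection of the line `u v` with the circle. -/
theorem exists_better_vertex (ha : 0 < a) (hlam : 0 < lam) (hlamab : lam * (a + b) ≤ 1)
    {u v w : Plane} (hu : ‖u‖ = b) (hw : ‖w‖ = b) (hv : ‖v‖ < b)
    (h1 : planeDet u v = a * ‖v - u‖) (h2 : planeDet v w = a * ‖w - v‖)
    (hT : 0 < planeDet (v - u) (w - v)) :
    ∃ τ : ℝ, 1 < τ ∧ ‖u + τ • (v - u)‖ = b ∧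
      a * ‖w - (u + τ • (v - u))‖ ≤ planeDet (u + τ • (v - u)) w ∧
      sideJ lam u (u + τ • (v - u)) + sideJ lam (u + τ • (v - u)) w <
        sideJ lam u v + sideJ lam v w := by
  have hb0 : 0 < b := lt_of_le_of_lt (norm_nonneg v) hv
  have hL1 : 0 < ‖v - u‖ := by
    rw [norm_pos_iff]; intro h; rw [h, planeDet.zero_left] at hT; exact lt_irrefl _ hT
  have hL2 : 0 < ‖w - v‖ := by
    rw [norm_pos_iff]; intro h; rw [h, planeDet.zero_right] at hT; exact lt_irrefl _ hT
  obtain ⟨L₁, hL₁⟩ : ∃ L, L = ‖v - u‖ := ⟨_, rfl⟩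
  obtain ⟨L₂, hL₂⟩ : ∃ L, L = ‖w - v‖ := ⟨_, rfl⟩
  rw [← hL₁] at h1 hL1
  rw [← hL₂] at h2 hL2
  obtain ⟨e, he⟩ : ∃ e, e = (L₁⁻¹) • (v - u) := ⟨_, rfl⟩
  have hve : v - u = L₁ • e := by rw [he, smul_smul, mul_inv_cancel₀ hL1.ne', one_smul]
  have hen : ‖e‖ = 1 := by
    rw [he, norm_smul, ← hL₁, norm_inv, Real.norm_eq_abs, abs_of_pos hL1, inv_mul_cancel₀ hL1.ne']
  have hen2 : e 0 ^ 2 + e 1 ^ 2 = 1 := by rw [← plane_norm_sq, hen]; norm_num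
  have hv0 : v 0 = u 0 + L₁ * e 0 := by
    have := congrArg (fun z : Plane => z 0) hve; simp at this; linarith
  have hv1 : v 1 = u 1 + L₁ * e 1 := by
    have := congrArg (fun z : Plane => z 1) hve; simp at this; linarith
  have hua : u 0 * e 1 - u 1 * e 0 = a := by
    simp only [planeDet] at h1
    rw [hv0, hv1] at h1
    have : L₁ * (u 0 * e 1 - u 1 * e 0 - a) = 0 := by linear_combination h1
    rcases mul_eq_zero.1 this with h | h <;> linarith
  -- coordinates in the orthonormal frame `(n, e)` with `n` the outer normal of the side `u v`
  obtain ⟨c, hc⟩ : ∃ c, c = u 0 * e 0 + u 1 * e 1 := ⟨_, rfl⟩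
  obtain ⟨x, hx⟩ : ∃ x, x = w 0 * e 1 - w 1 * e 0 := ⟨_, rfl⟩
  obtain ⟨y, hy⟩ : ∃ y, y = w 0 * e 0 + w 1 * e 1 := ⟨_, rfl⟩
  have hu0 : u 0 = a * e 1 + c * e 0 := by
    rw [← hua, hc]; linear_combination (-u 0) * hen2
  have hu1 : u 1 = -a * e 0 + c * e 1 := by
    rw [← hua, hc]; linear_combination (-u 1) * hen2
  have hw0 : w 0 = x * e 1 + y * e 0 := by
    rw [hx, hy]; linear_combination (-w 0) * hen2
  have hw1 : w 1 = -x * e 0 + y * e 1 := by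
    rw [hx, hy]; linear_combination (-w 1) * hen2
  have hub : a ^ 2 + c ^ 2 = b ^ 2 := by
    rw [← hu, plane_norm_sq, hu0, hu1]; linear_combination (-(a ^ 2 + c ^ 2)) * hen2
  have hwb : x ^ 2 + y ^ 2 = b ^ 2 := by
    rw [← hw, plane_norm_sq, hw0, hw1]; linear_combination (-(x ^ 2 + y ^ 2)) * hen2
  have hvb : a ^ 2 + (c + L₁) ^ 2 < b ^ 2 := by
    have : ‖v‖ ^ 2 < b ^ 2 := by gcongr
    rw [plane_norm_sq, hv0, hv1, hu0, hu1] at this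
    have e2 : (a * e 1 + c * e 0 + L₁ * e 0) ^ 2 + (-a * e 0 + c * e 1 + L₁ * e 1) ^ 2 =
      a ^ 2 + (c + L₁) ^ 2 := by linear_combination (a ^ 2 + (c + L₁) ^ 2) * hen2
    linarith
  obtain ⟨r, hr⟩ : ∃ r, r = -c := ⟨_, rfl⟩
  obtain ⟨s, hs⟩ : ∃ s, s = c + L₁ := ⟨_, rfl⟩
  have hcL : L₁ * (2 * c + L₁) < 0 := by linarith
  have hcL' : 2 * c + L₁ < 0 := by
    by_contra hcon
    linarith [mul_nonneg hL1.le (not_lt.1 hcon)]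
  have hr0 : 0 < r := by linarith
  have hsr : s ^ 2 < r ^ 2 := by rw [hs, hr]; linarith
  have k1 : (x - a) ^ 2 + (y - s) ^ 2 = L₂ ^ 2 := by
    rw [hL₂, plane_norm_sq]
    simp only [PiLp.sub_apply]
    rw [hv0, hv1, hu0, hu1, hw0, hw1, hs]
    linear_combination (-((x - a) ^ 2 + (y - c - L₁) ^ 2)) * hen2
  have k3 : a * y - s * x = a * L₂ := by
    rw [← h2, planeDet, hv0, hv1, hu0, hu1, hw0, hw1, hs]
    linear_combination (-(a * y - (c + L₁) * x)) * hen2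
  have k4 : x < a := by
    have : planeDet (v - u) (w - v) = L₁ * (a - x) := by
      simp only [planeDet, PiLp.sub_apply]
      rw [hv0, hv1, hu0, hu1, hw0, hw1]
      linear_combination (L₁ * (a - x)) * hen2
    rw [this] at hT
    linarith [pos_of_mul_pos_right hT hL1.le]
  obtain ⟨hs0, hLrs, hX, hY⟩ := tangent_coords ha hr0 hsr hL2 k1
    (by rw [hwb, ← hub, hr]; ring) k3 k4
  have hsltr : s < r := lt_of_pow_lt_pow_left₀ 2 hr0.le hsr
  have hL1rs : L₁ = r + s := by rw [hr, hs]; ring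
  obtain ⟨g, hg0, hg⟩ : ∃ g, 0 < g ∧ g ^ 2 = a ^ 2 + s ^ 2 :=
    ⟨√(a ^ 2 + s ^ 2), by positivity, Real.sq_sqrt (by positivity)⟩
  have hbr : b ^ 2 = a ^ 2 + r ^ 2 := by rw [← hub, hr]; ring
  have hgb : g < b := lt_of_pow_lt_pow_left₀ 2 hb0.le (by rw [hg, hbr]; linarith)
  have hag : a < g := lt_of_pow_lt_pow_left₀ 2 hg0.le (by rw [hg]; linarith [pow_pos hs0 2])
  -- Here `g` is the norm of `v`; `ℓ` will be the length of the new side `m w` and `η` its distance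
  -- from the origin.
  obtain ⟨ℓ, hℓ⟩ : ∃ ℓ, ℓ = 2 * b * s / g := ⟨_, rfl⟩
  obtain ⟨η, hη⟩ : ∃ η, η = a * b / g := ⟨_, rfl⟩
  have hℓ0 : 0 < ℓ := by rw [hℓ]; positivity
  have hηa : a < η := by rw [hη, lt_div_iff₀ hg0]; exact mul_lt_mul_of_pos_left hgb ha
  have hηb : η < b := by rw [hη, div_lt_iff₀ hg0, mul_comm]; exact mul_lt_mul_of_pos_left hag hb0
  -- The second intersection is `m = (a, r)` in the frame, so `u m` has length `2 * r`, while `u v`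
  -- has length `L₁ = r + s`.
  refine ⟨2 * r / L₁, by rw [lt_div_iff₀ hL1]; linarith, ?_⟩
  have hm : u + (2 * r / L₁) • (v - u) = u + (2 * r) • e := by
    rw [hve, smul_smul, div_mul_cancel₀ _ hL1.ne']
  rw [hm]
  obtain ⟨m, hmm⟩ : ∃ m, m = u + (2 * r) • e := ⟨_, rfl⟩
  rw [← hmm]
  have hm0 : m 0 = a * e 1 + r * e 0 := by
    rw [hmm]; simp only [PiLp.add_apply, PiLp.smul_apply, smul_eq_mul]; rw [hu0, hr]; ring
  have hm1 : m 1 = -a * e 0 + r * e 1 := by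
    rw [hmm]; simp only [PiLp.add_apply, PiLp.smul_apply, smul_eq_mul]; rw [hu1, hr]; ring
  have hmn : ‖m‖ = b := by
    rw [← sq_eq_sq₀ (norm_nonneg _) hb0.le, plane_norm_sq, hm0, hm1, hbr]
    linear_combination (a ^ 2 + r ^ 2) * hen2
  have hg2 : g ^ 2 ≠ 0 := by positivity
  have hℓη : ℓ * η = 2 * a * s * b ^ 2 / g ^ 2 := by rw [hℓ, hη]; field_simp
  rw [← hg] at hX hY
  rw [hLrs] at hX hY
  have hdet : planeDet m w = ℓ * η := by
    have e1 : planeDet m w = a * y - r * x := by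
      rw [planeDet, hm0, hm1, hw0, hw1]
      linear_combination (a * y - r * x) * hen2
    rw [e1, hℓη, eq_div_iff hg2, hbr]
    linear_combination a * hY - r * hX + a * (s - r) * hg
  have hdist : ‖w - m‖ = ℓ := by
    rw [← sq_eq_sq₀ (norm_nonneg _) hℓ0.le, plane_norm_sq]
    simp only [PiLp.sub_apply]
    have e1 : (w 0 - m 0) ^ 2 + (w 1 - m 1) ^ 2 = 2 * b ^ 2 - 2 * (a * x + r * y) := by
      rw [hm0, hm1, hw0, hw1]
      linear_combination ((x - a) ^ 2 + (y - r) ^ 2) * hen2 + hwb - hbr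
    have e2 : ℓ ^ 2 = 4 * b ^ 2 * s ^ 2 / g ^ 2 := by rw [hℓ]; field_simp; ring
    rw [e1, e2, eq_div_iff hg2, hbr]
    linear_combination (-2 * a) * hX - 2 * r * hY + (2 * r ^ 2 - 2 * r * s) * hg
  refine ⟨hmn, ?_, ?_⟩
  · rw [hdist, hdet, mul_comm]; exact mul_le_mul_of_nonneg_left hηa.le hℓ0.le
  · have hum : ‖m - u‖ = 2 * r := by
      rw [hmm, add_sub_cancel_left, norm_smul, hen, Real.norm_eq_abs, abs_of_pos (by positivity),
        mul_one]
    have hdum : planeDet u m = 2 * r * a := by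
      rw [planeDet, hm0, hm1, hu0, hu1, hr]
      linear_combination (-2 * c * a) * hen2
    simp only [sideJ]
    rw [hum, hdum, hdist, hdet, h1, h2, ← hL₁, ← hL₂, hLrs, hL1rs]
    have hs2 : 2 * s * η = a * ℓ := by rw [hℓ, hη]; field_simp
    have hη0 : 0 < η := ha.trans hηa
    -- The first factor on the left is the change of the functional, because `u v` and `v w` both
    -- have length `r + s` and distance `a` from the origin. Multiplication by `η` and the relation
    -- `hs2` produce a factorization with visible sign.
    have key : (lam / 2 * (ℓ * η - 2 * a * s) - (ℓ - 2 * s)) * η =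
        ℓ * (η - a) * (lam * (η + a) / 2 - 1) := by
      linear_combination (1 - lam / 2 * a) * hs2
    have hneg : ℓ * (η - a) * (lam * (η + a) / 2 - 1) < 0 := by
      refine mul_neg_of_pos_of_neg (mul_pos hℓ0 (by linarith)) ?_
      have : lam * (η + a) ≤ lam * (a + b) :=
        mul_le_mul_of_nonneg_left (by linarith) hlam.le
      linarith
    have : lam / 2 * (ℓ * η - 2 * a * s) - (ℓ - 2 * s) < 0 := by
      rw [← key] at hneg
      by_contra hcon
      have := mul_nonneg (not_lt.1 hcon) hη0.le
      linarith
    linarith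

end

/-! ### Prolonging a side to the circle; optimal polygons are inscribed. -/

section

variable {a b lam : ℝ} {n : ℕ} {p : Polygon Plane n}

theorem dot_sub_neg {w z : Plane} (hw : ‖w‖ = b) (hz : ‖z‖ ≤ b) (hne : z ≠ w) :
    (z 0 - w 0) * w 0 + (z 1 - w 1) * w 1 < 0 := by
  have h1 : 0 < ‖z - w‖ := norm_pos_iff.2 (sub_ne_zero.2 hne)
  have h2 : ‖z‖ ^ 2 ≤ ‖w‖ ^ 2 := by rw [hw]; gcongr
  have h3 : 0 < ‖z - w‖ ^ 2 := by positivity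
  rw [plane_norm_sq] at h2 h3
  rw [plane_norm_sq] at h2
  simp only [PiLp.sub_apply] at h3
  linarith

/-- If `w` is on the circle, `v`, `m`, `z` are in the disk, `m` is to the right of `v w` and `z`
to the left of it, then `z` is to the left of `m w`. -/
theorem left_of_chord {v m w z : Plane} (hw : ‖w‖ = b) (hv : ‖v‖ ≤ b) (hm : ‖m‖ ≤ b)
    (hz : ‖z‖ ≤ b) (hmw : planeDet (w - v) (m - v) < 0) (hzw : 0 < planeDet (w - v) (z - v)) :
    0 < planeDet (w - m) (z - m) := by
  have hvw : v ≠ w := by rintro rfl; simp at hzw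
  have hm' : m ≠ w := by rintro rfl; simp at hmw
  have hz' : z ≠ w := by rintro rfl; simp at hzw
  have X := dot_sub_neg hw hv hvw
  have Y := dot_sub_neg hw hm hm'
  have Z := dot_sub_neg hw hz hz'
  by_contra hcon
  have hcon := not_lt.1 hcon
  -- The linear relation between the three plane vectors `v - w`, `m - w`, `z - w`, with
  -- determinants as coefficients, is paired with `w`. All three pairings are negative by
  -- `dot_sub_neg`.
  have id : planeDet (w - m) (z - m) * ((v 0 - w 0) * w 0 + (v 1 - w 1) * w 1) +
      planeDet (w - v) (m - v) * ((z 0 - w 0) * w 0 + (z 1 - w 1) * w 1) =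
      planeDet (w - v) (z - v) * ((m 0 - w 0) * w 0 + (m 1 - w 1) * w 1) := by
    simp only [planeDet, PiLp.sub_apply]; ring
  have a1 := mul_nonneg_of_nonpos_of_nonpos hcon X.le
  have a2 := mul_pos_of_neg_of_neg hmw Z
  have a3 := mul_neg_of_pos_of_neg hzw Y
  linarith

/-- Pushing a vertex of a convex polygon along a side until it meets a circle that encloses the
polygon and contains the next vertex yields a convex polygon. -/
theorem IsConvexNGon.moveVertex_along_side (hp : IsConvexNGon p) (hpb : ∀ i, ‖p i‖ ≤ b)
    (h : Fin n) {τ : ℝ} (hτ : 1 < τ) (hw : ‖p (finRotate n (finRotate n h))‖ = b)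
    (hm : ‖p h + τ • (p (finRotate n h) - p h)‖ ≤ b) :
    IsConvexNGon (moveVertex p (finRotate n h) (p h + τ • (p (finRotate n h) - p h))) := by
  have hn := hp.1
  have n1 := finRotate_ne_self (show 2 ≤ n by omega) h
  have n2 := finRotate_ne_self (show 2 ≤ n by omega) (finRotate n h)
  have n3 := finRotate_ne_self (show 2 ≤ n by omega) (finRotate n (finRotate n h))
  have n4 := finRotate_finRotate_ne_self hn h
  have n5 := finRotate_finRotate_ne_self hn (finRotate n h)
  set i₁ := finRotate n h with hi₁
  set i₂ := finRotate n i₁ with hi₂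
  set u := p h with hu
  set v := p i₁ with hv
  set w := p i₂ with hw'
  obtain ⟨m, hmm⟩ : ∃ m, m = u + τ • (v - u) := ⟨_, rfl⟩
  rw [← hmm] at hm ⊢
  have hmv : planeDet (w - v) (m - v) < 0 := by
    have h1 : planeDet (w - v) (m - v) = (1 - τ) * planeDet (w - v) (u - v) := by
      rw [hmm]
      simp only [planeDet, PiLp.add_apply, PiLp.sub_apply, PiLp.smul_apply, smul_eq_mul]; ring
    rw [h1]
    exact mul_neg_of_neg_of_pos (by linarith) (hp.2 i₁ h n1.symm n4.symm)
  have hleft : ∀ k, k ≠ i₁ → k ≠ i₂ → 0 < planeDet (w - m) (p k - m) := fun k h1 h2 =>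
    left_of_chord hw (hpb i₁) hm (hpb k) hmv (hp.2 i₁ k h1 h2)
  refine ⟨hn, fun i k hki hki' => ?_⟩
  by_cases hi0 : i = h
  · rw [hi0, ← hi₁] at hki' ⊢
    rw [hi0] at hki
    rw [moveVertex_self, moveVertex_ne _ n1.symm, moveVertex_ne _ hki']
    have := hp.2 h k hki hki'
    have e : planeDet (m - u) (p k - u) = τ * planeDet (v - u) (p k - u) := by
      rw [hmm, add_sub_cancel_left, planeDet.smul_left]
    rw [e]
    exact mul_pos (by linarith) this
  by_cases hi1 : i = i₁
  · rw [hi1, ← hi₂] at hki' ⊢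
    rw [hi1] at hki
    rw [moveVertex_self, moveVertex_ne _ n2, moveVertex_ne _ hki]
    exact hleft k hki hki'
  have hi' : finRotate n i ≠ i₁ := fun e => hi0 ((finRotate n).injective e)
  rw [moveVertex_ne _ hi1, moveVertex_ne _ hi']
  by_cases hk : k = i₁
  swap
  · rw [moveVertex_ne _ hk]
    exact hp.2 i k hki hki'
  rw [hk, moveVertex_self]
  by_cases hi2 : i = i₂
  · have := hleft (finRotate n i₂) n5 n3
    rw [hi2]
    simp only [planeDet, PiLp.sub_apply] at this ⊢
    linarith
  by_contra hcon
  have hcon := not_lt.1 hcon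
  have k1 := hp.2 i i₁ (Ne.symm hi1) (Ne.symm hi')
  have k2 := hp.sideFun_nonneg i i₂
  have k3 := hleft i hi1 hi2
  have k4 := hp.2 i₁ i hi1 hi2
  have k5 := hp.sideFun_nonneg h i
  rw [sideFun] at k2 k5
  set y := p i
  set y' := p (finRotate n i)
  rw [← hv] at k1
  rw [← hw'] at k2
  rw [← hi₂, ← hw', ← hv] at k4
  rw [← hi₁, ← hv, ← hu] at k5
  -- This is the affine relation between `v`, `m`, `w`, `y`, weighted by signed areas and evaluated
  -- on the function of the side `y y'`, which vanishes at `y`. If `m` were not strictly to the left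
  -- of that side, the first term would be positive and the others nonnegative.
  have id : planeDet (w - m) (y - m) * planeDet (y' - y) (v - y) +
      (-planeDet (w - v) (y - v)) * planeDet (y' - y) (m - y) +
      (τ - 1) * planeDet (v - u) (y - u) * planeDet (y' - y) (w - y) = 0 := by
    rw [hmm]
    simp only [planeDet, PiLp.add_apply, PiLp.sub_apply, PiLp.smul_apply, smul_eq_mul]; ring
  have a1 := mul_pos k3 k1
  have a2 := mul_nonneg_of_nonpos_of_nonpos (neg_neg_of_pos k4).le hcon
  have a3 := mul_nonneg (mul_nonneg (sub_nonneg.2 hτ.le) k5) k2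
  linarith

/-- An optimal polygon is inscribed in the large circle. -/
theorem IsOptimalPolygon.norm_eq (ha : 0 < a) (hb : 0 < b) (hlam : 0 < lam)
    (hlamab : lam * (a + b) ≤ 1) (hp : IsOptimalPolygon a b lam p) (i : Fin n) : ‖p i‖ = b := by
  obtain ⟨h, rfl⟩ := (finRotate n).surjective i
  refine le_antisymm (hp.1.norm_le _) (not_lt.1 fun hv => ?_)
  have hla : lam * a < 1 := by
    have : 0 < lam * b := mul_pos hlam hb
    linarith
  have hn := hp.1.convex.1
  have hu : ‖p h‖ = b := by
    refine le_antisymm (hp.1.norm_le _) (not_lt.1 fun hu => ?_)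
    obtain ⟨g, rfl⟩ := (finRotate n).surjective h
    exact hp.not_both_interior ha hla g hu hv
  have hw : ‖p (finRotate n (finRotate n h))‖ = b :=
    le_antisymm (hp.1.norm_le _) (not_lt.1 fun hw => hp.not_both_interior ha hla h hv hw)
  obtain ⟨τ, hτ, hm, hle, hlt⟩ := exists_better_vertex ha hlam hlamab hu hw hv
    (hp.tangent_prev h hv) (hp.tangent_next h hv) (hp.1.convex.turn_pos h)
  have hconv := hp.1.convex.moveVertex_along_side hp.1.norm_le h hτ hw hm.le
  have hadm := hp.1.moveVertex h hconv hm.le (by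
    have l1 := hp.1.le_det h
    rw [add_sub_cancel_left, norm_smul, Real.norm_eq_abs, abs_of_pos (by linarith)]
    have e : planeDet (p h) (p h + τ • (p (finRotate n h) - p h)) =
        τ * planeDet (p h) (p (finRotate n h)) := by
      rw [planeDet.add_right, planeDet.smul_right, planeDet.sub_right, planeDet.self]; ring
    rw [e]
    calc a * (τ * ‖p (finRotate n h) - p h‖) = τ * (a * ‖p (finRotate n h) - p h‖) := by ring
      _ ≤ _ := by gcongr) hle
  have h1 := hp.2 n _ hadm
  have h2 := polyJ_moveVertex (lam := lam) (by omega) p h (p h + τ • (p (finRotate n h) - p h))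
  linarith

end

/-- The point with polar coordinates `(b, φ)`. -/
noncomputable def polarPoint (b φ : ℝ) : Plane := !₂[b * Real.cos φ, b * Real.sin φ]

/-! ### Inscribed polygons and the half-angles of their sides. -/

section

variable {a b lam : ℝ} {n : ℕ} {p : Polygon Plane n}

theorem polarPoint_zero (b φ : ℝ) : polarPoint b φ 0 = b * Real.cos φ := rfl
theorem polarPoint_one (b φ : ℝ) : polarPoint b φ 1 = b * Real.sin φ := rfl

theorem norm_polarPoint (hb : 0 ≤ b) (φ : ℝ) : ‖polarPoint b φ‖ = b := by
  rw [← sq_eq_sq₀ (norm_nonneg _) hb, plane_norm_sq, polarPoint_zero, polarPoint_one]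
  linear_combination b ^ 2 * Real.sin_sq_add_cos_sq φ

theorem polarPoint_add_two_pi (b φ : ℝ) : polarPoint b (φ + 2 * Real.pi) = polarPoint b φ := by
  simp [polarPoint]

theorem planeDet_polarPoint (b φ ψ : ℝ) :
    planeDet (polarPoint b φ) (polarPoint b ψ) = b ^ 2 * Real.sin (ψ - φ) := by
  rw [planeDet, polarPoint_zero, polarPoint_zero, polarPoint_one, polarPoint_one, Real.sin_sub]
  ring

theorem norm_polarPoint_sub (hb : 0 ≤ b) {θ : ℝ} (h0 : 0 ≤ Real.sin θ) (φ : ℝ) :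
    ‖polarPoint b (φ + 2 * θ) - polarPoint b φ‖ = 2 * b * Real.sin θ := by
  rw [← sq_eq_sq₀ (norm_nonneg _) (by positivity), plane_norm_sq]
  simp only [PiLp.sub_apply, polarPoint_zero, polarPoint_one, Real.cos_add, Real.sin_add,
    Real.sin_two_mul, Real.cos_two_mul]
  linear_combination (4 * b ^ 2 * (Real.cos θ ^ 2 * Real.cos φ ^ 2 + Real.cos θ ^ 2 *
    Real.sin φ ^ 2 - Real.cos φ ^ 2 - Real.sin φ ^ 2)) * Real.sin_sq_add_cos_sq θ +
    (4 * b ^ 2 * Real.sin θ ^ 2) * Real.sin_sq_add_cos_sq φ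

/-- In this factored form of twice the signed area of an inscribed triangle, convexity is read off
from the signs of sines. -/
theorem planeDet_chords (b x A B : ℝ) :
    planeDet (polarPoint b (x + 2 * A) - polarPoint b x) (polarPoint b (x + 2 * B) -
      polarPoint b x) = 4 * b ^ 2 * Real.sin A * Real.sin (B - A) * Real.sin B := by
  rw [planeDet.sub_left, planeDet.sub_right, planeDet.sub_right, planeDet.self]
  simp only [planeDet_polarPoint]
  rw [show x + 2 * B - (x + 2 * A) = 2 * (B - A) by ring, show x - (x + 2 * A) = -(2 * A) by ring,
    show x + 2 * B - x = 2 * B by ring, Real.sin_neg]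
  simp only [Real.sin_two_mul, Real.sin_sub, Real.cos_sub]
  have hA := Real.sin_sq_add_cos_sq A
  have hB := Real.sin_sq_add_cos_sq B
  have e1 : Real.cos A ^ 2 = 1 - Real.sin A ^ 2 := by linarith
  have e2 : Real.cos B ^ 2 = 1 - Real.sin B ^ 2 := by linarith
  linear_combination b ^ 2 * (2 * Real.sin B * Real.cos B) * e1 -
    b ^ 2 * (2 * Real.sin A * Real.cos A) * e2

/-- The contribution to the functional of a chord of half-angle `θ`. -/
noncomputable def chordJ (b lam θ : ℝ) : ℝ :=
  lam * b ^ 2 * (Real.sin θ * Real.cos θ) - 2 * b * Real.sin θ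

theorem sideJ_polarPoint (hb : 0 ≤ b) {θ : ℝ} (h0 : 0 ≤ Real.sin θ) (φ : ℝ) :
    sideJ lam (polarPoint b φ) (polarPoint b (φ + 2 * θ)) = chordJ b lam θ := by
  rw [sideJ, planeDet_polarPoint, norm_polarPoint_sub hb h0, add_sub_cancel_left,
    Real.sin_two_mul, chordJ]
  ring

theorem exists_polarPoint (hb : 0 < b) {u : Plane} (hu : ‖u‖ = b) : ∃ φ, u = polarPoint b φ := by
  have h : u 0 ^ 2 + u 1 ^ 2 = b ^ 2 := by rw [← plane_norm_sq, hu]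
  have hz : ‖(⟨u 0, u 1⟩ : ℂ)‖ = b := by
    rw [← sq_eq_sq₀ (norm_nonneg _) hb.le, Complex.sq_norm, Complex.normSq_mk]; linarith
  refine ⟨Complex.arg ⟨u 0, u 1⟩, plane_ext ?_ ?_⟩
  · rw [polarPoint_zero, ← hz, Complex.norm_mul_cos_arg]
  · rw [polarPoint_one, ← hz, Complex.norm_mul_sin_arg]

/-- Differences of polar angles are known only modulo 2π; `Real.arccos` selects the representative
in (0, π), where the positive sine is recovered from the cosine. -/
theorem exists_half_angle {x : ℝ} (h : 0 < Real.sin x) :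
    ∃ θ, 0 < θ ∧ θ < Real.pi / 2 ∧ Real.cos (2 * θ) = Real.cos x ∧
      Real.sin (2 * θ) = Real.sin x := by
  have hc : Real.cos (Real.arccos (Real.cos x)) = Real.cos x :=
    Real.cos_arccos (Real.neg_one_le_cos x) (Real.cos_le_one x)
  have hs : Real.sin (Real.arccos (Real.cos x)) = Real.sin x := by
    rw [Real.sin_arccos, ← Real.sin_sq, Real.sqrt_sq h.le]
  have h0 := Real.arccos_nonneg (Real.cos x)
  have hpi := Real.arccos_le_pi (Real.cos x)
  have h1 : Real.arccos (Real.cos x) ≠ 0 := fun e => by rw [e] at hs; simp at hs; linarith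
  have h2 : Real.arccos (Real.cos x) ≠ Real.pi := fun e => by rw [e] at hs; simp at hs; linarith
  have h1 := lt_of_le_of_ne h0 h1.symm
  have h2 := lt_of_le_of_ne hpi h2
  refine ⟨Real.arccos (Real.cos x) / 2, by linarith, by linarith, ?_, ?_⟩ <;>
    rw [mul_div_cancel₀ _ two_ne_zero] <;> assumption

/-- Twice the sum of the first `k` terms. -/
noncomputable def angleSum (θ : Fin n → ℝ) (k : ℕ) : ℝ :=
  ∑ j ∈ Finset.range k, 2 * (if h : j < n then θ ⟨j, h⟩ else 0)

theorem angleSum_zero (θ : Fin n → ℝ) : angleSum θ 0 = 0 := by simp [angleSum]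

theorem angleSum_succ (θ : Fin n → ℝ) (i : Fin n) :
    angleSum θ (i + 1) = angleSum θ i + 2 * θ i := by
  simp [angleSum, Finset.sum_range_succ]

theorem angleSum_last (θ : Fin n → ℝ) : angleSum θ n = 2 * ∑ i, θ i := by
  rw [angleSum, ← Fin.sum_univ_eq_sum_range (fun j => 2 * (if h : j < n then θ ⟨j, h⟩ else 0)),
    Finset.mul_sum]
  simp

theorem angleSum_lt {θ : Fin n → ℝ} (hθ : ∀ i, 0 < θ i) {j k : ℕ} (hjk : j < k) (hk : k ≤ n) :
    angleSum θ j < angleSum θ k := by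
  induction k with
  | zero => omega
  | succ k ih =>
    have e := angleSum_succ θ ⟨k, by omega⟩
    have := hθ ⟨k, by omega⟩
    simp only at e
    rcases eq_or_lt_of_le (Nat.lt_succ_iff.1 hjk) with rfl | h
    · linarith
    · have := ih h (by omega); linarith

theorem finRotate_val_of_lt {i : Fin n} (h : (i : ℕ) + 1 < n) :
    finRotate n i = ⟨i + 1, h⟩ := by
  obtain ⟨m, rfl⟩ : ∃ m, n = m + 1 := ⟨n - 1, by omega⟩
  exact finRotate_of_lt (by omega)

theorem finRotate_val_of_eq {i : Fin n} (h : (i : ℕ) + 1 = n) :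
    finRotate n i = ⟨0, by omega⟩ := by
  obtain ⟨m, rfl⟩ : ∃ m, n = m + 1 := ⟨n - 1, by omega⟩
  have : i = Fin.last m := Fin.ext (by simp; omega)
  rw [show finRotate (m + 1) i = 0 by rw [this, finRotate_last]]; rfl

theorem cos_le_of_admissible_side (hb : 0 < b) {θ : ℝ} (hs : 0 < Real.sin θ) :
    a * (2 * b * Real.sin θ) ≤ b ^ 2 * Real.sin (2 * θ) ↔ a ≤ b * Real.cos θ := by
  rw [Real.sin_two_mul]
  have : 0 < 2 * b * Real.sin θ := by positivity
  rw [show b ^ 2 * (2 * Real.sin θ * Real.cos θ) = b * Real.cos θ * (2 * b * Real.sin θ) by ring]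
  exact mul_le_mul_iff_of_pos_right this

/-- A convex polygon inscribed in a circle turns around once: the half-angles of its sides, seen
from the center, add up to `π`. -/
theorem sum_half_angles_eq_pi (hp : IsConvexNGon p) (hb : 0 < b) {θ : Fin n → ℝ}
    (hθ : ∀ i, 0 < θ i) (hθ' : ∀ i, θ i < Real.pi / 2)
    (hrot : ∀ i φ, p i = polarPoint b φ → p (finRotate n i) = polarPoint b (φ + 2 * θ i))
    {φ₀ : ℝ} (h0 : ∀ h : 0 < n, p ⟨0, h⟩ = polarPoint b φ₀) : ∑ i, θ i = Real.pi := by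
  have hn := hp.1
  have hpi := Real.pi_pos
  have hpos : ∀ k (hk : k < n), p ⟨k, hk⟩ = polarPoint b (φ₀ + angleSum θ k) := by
    intro k
    induction k with
    | zero => intro hk; rw [angleSum_zero, add_zero]; exact h0 hk
    | succ k ih =>
      intro hk
      have h1 := hrot ⟨k, by omega⟩ _ (ih (by omega))
      rw [finRotate_val_of_lt (i := ⟨k, by omega⟩) hk] at h1
      have e := angleSum_succ θ ⟨k, by omega⟩
      simp only at e h1
      rw [h1, e, add_assoc]
  have hclose : polarPoint b φ₀ = polarPoint b (φ₀ + angleSum θ n) := by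
    have hlast : n - 1 + 1 = n := by omega
    have h1 := hrot ⟨n - 1, by omega⟩ _ (hpos (n - 1) (by omega))
    rw [finRotate_val_of_eq (i := ⟨n - 1, by omega⟩) hlast, h0] at h1
    have e := angleSum_succ θ ⟨n - 1, by omega⟩
    simp only [hlast] at e
    rw [h1, e, add_assoc]
  have hcos : Real.cos (angleSum θ n) = 1 := by
    have c0 := congrArg (fun z : Plane => z 0) hclose
    have c1 := congrArg (fun z : Plane => z 1) hclose
    simp only [polarPoint_zero, polarPoint_one] at c0 c1
    have c0 := mul_left_cancel₀ hb.ne' c0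
    have c1 := mul_left_cancel₀ hb.ne' c1
    have : Real.cos (angleSum θ n) =
        Real.cos φ₀ * Real.cos (φ₀ + angleSum θ n) + Real.sin φ₀ * Real.sin (φ₀ + angleSum θ n) := by
      rw [add_comm (Real.cos φ₀ * _), add_comm, ← Real.cos_sub]
      conv_lhs => rw [show angleSum θ n = (φ₀ + angleSum θ n) - φ₀ by ring]
      rw [Real.cos_sub]
      rw [Real.cos_sub]
      ring
    rw [this, ← c0, ← c1]
    linarith [Real.sin_sq_add_cos_sq φ₀]
  obtain ⟨K, hK⟩ := (Real.cos_eq_one_iff _).1 hcos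
  have hS0 : 0 < angleSum θ n := by
    have := angleSum_lt hθ (show 0 < n by omega) le_rfl
    rwa [angleSum_zero] at this
  have hK1 : K = 1 := by
    have hKpos : 0 < K := by
      rw [← hK] at hS0
      exact_mod_cast pos_of_mul_pos_left hS0 (by positivity)
    by_contra hne
    have hK2 : (2 : ℝ) ≤ K := by exact_mod_cast (show 2 ≤ K by omega)
    have hbig : 4 * Real.pi ≤ angleSum θ n := by rw [← hK]; nlinarith
    -- If the polygon turned more than once, some side would be the first to pass the starting
    -- vertex. That vertex would then fail to lie strictly to the left of this side.
    have hex : ∃ k, 2 * Real.pi < angleSum θ k := ⟨n, by linarith⟩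
    classical
    obtain ⟨hj1, hj2⟩ := And.intro (Nat.find_spec hex) fun m => Nat.find_min (m := m) hex
    have hjn : Nat.find hex ≤ n := Nat.find_min' hex (by linarith)
    obtain ⟨j, hj⟩ : ∃ j, Nat.find hex = j + 1 := by
      refine ⟨Nat.find hex - 1, ?_⟩
      rcases Nat.eq_zero_or_pos (Nat.find hex) with h | h
      · rw [h, angleSum_zero] at hj1; linarith
      · omega
    rw [hj] at hj1 hjn
    have hjle : angleSum θ j ≤ 2 * Real.pi := not_lt.1 (hj2 j (by omega))
    have e := angleSum_succ θ ⟨j, by omega⟩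
    simp only at e
    have hθj := hθ ⟨j, by omega⟩
    have hθj' := hθ' ⟨j, by omega⟩
    have hjn' : j + 1 < n := by
      by_contra h
      have : j + 1 = n := by omega
      have := congrArg (angleSum θ) this
      linarith
    have hj0 : 0 < j := by
      rcases Nat.eq_zero_or_pos j with rfl | h
      · rw [angleSum_zero] at e; linarith
      · exact h
    have hdet := hp.2 ⟨j, by omega⟩ ⟨0, by omega⟩ (by simp; omega) (by
      rw [finRotate_val_of_lt (i := ⟨j, by omega⟩) hjn']; simp)
    rw [finRotate_val_of_lt (i := ⟨j, by omega⟩) hjn', hpos, hpos, h0] at hdet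
    simp only at hdet
    have e1 : φ₀ + angleSum θ (j + 1) = φ₀ + angleSum θ j + 2 * θ ⟨j, by omega⟩ := by
      rw [e]; ring
    have e2 : polarPoint b φ₀ = polarPoint b (φ₀ + angleSum θ j + 2 * (-(angleSum θ j) / 2)) := by
      congr 1; ring
    rw [e1, e2, planeDet_chords] at hdet
    have hA : 0 < Real.sin (θ ⟨j, by omega⟩) := Real.sin_pos_of_pos_of_lt_pi hθj (by linarith)
    have hB : 0 ≤ Real.sin (angleSum θ j / 2) := by
      have := angleSum_lt hθ hj0 (by omega)
      rw [angleSum_zero] at this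
      exact Real.sin_nonneg_of_nonneg_of_le_pi (by linarith) (by linarith)
    have hC : Real.sin (angleSum θ (j + 1) / 2) < 0 := by
      rw [← neg_pos, ← Real.sin_sub_pi]
      exact Real.sin_pos_of_pos_of_lt_pi (by linarith) (by linarith)
    rw [show -angleSum θ j / 2 - θ ⟨j, by omega⟩ = -(angleSum θ (j + 1) / 2) by rw [e]; ring,
      show -angleSum θ j / 2 = -(angleSum θ j / 2) by ring, Real.sin_neg, Real.sin_neg] at hdet
    have : 4 * b ^ 2 * Real.sin (θ ⟨j, by omega⟩) * -Real.sin (angleSum θ (j + 1) / 2) *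
        -Real.sin (angleSum θ j / 2) ≤ 0 := by
      apply mul_nonpos_of_nonneg_of_nonpos
      · apply mul_nonneg (by positivity); linarith
      · linarith
    linarith
  rw [angleSum_last, hK1] at hK
  push_cast at hK
  linarith

/-- The half-angles of the sides of an admissible inscribed polygon. -/
theorem IsAdmissible.exists_half_angles (ha : 0 < a) (hb : 0 < b) (hp : IsAdmissible a b p)
    (hpb : ∀ i, ‖p i‖ = b) :
    ∃ θ : Fin n → ℝ, (∀ i, 0 < θ i ∧ θ i < Real.pi / 2 ∧ a ≤ b * Real.cos (θ i)) ∧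
      ∑ i, θ i = Real.pi ∧ (∀ i, sideLength p i = 2 * b * Real.sin (θ i)) ∧
      polyJ lam p = ∑ i, chordJ b lam (θ i) := by
  choose φ hφ using fun i => exists_polarPoint hb (hpb i)
  have hsin : ∀ i, 0 < Real.sin (φ (finRotate n i) - φ i) := fun i => by
    have := hp.det_pos ha i
    rw [hφ i, hφ (finRotate n i), planeDet_polarPoint] at this
    exact pos_of_mul_pos_right this (by positivity)
  choose θ hθ0 hθ1 hθc hθs using fun i => exists_half_angle (hsin i)
  have hpi := Real.pi_pos
  have hsθ : ∀ i, 0 < Real.sin (θ i) := fun i =>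
    Real.sin_pos_of_pos_of_lt_pi (hθ0 i) (by linarith [hθ1 i])
  have hrot' : ∀ i, p (finRotate n i) = polarPoint b (φ i + 2 * θ i) := fun i => by
    have e : φ (finRotate n i) = φ i + (φ (finRotate n i) - φ i) := by ring
    rw [hφ (finRotate n i)]
    apply plane_ext
    · rw [polarPoint_zero, polarPoint_zero, Real.cos_add, hθc, hθs, ← Real.cos_add, ← e]
    · rw [polarPoint_one, polarPoint_one, Real.sin_add, hθc, hθs, ← Real.sin_add, ← e]
  have hrot : ∀ i ψ, p i = polarPoint b ψ → p (finRotate n i) = polarPoint b (ψ + 2 * θ i) := by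
    intro i ψ hψ
    rw [hφ i] at hψ
    have c0 := congrArg (fun z : Plane => z 0) hψ
    have c1 := congrArg (fun z : Plane => z 1) hψ
    simp only [polarPoint_zero, polarPoint_one] at c0 c1
    rw [hrot' i]
    apply plane_ext
    · rw [polarPoint_zero, polarPoint_zero, Real.cos_add, Real.cos_add]
      linear_combination Real.cos (2 * θ i) * c0 - Real.sin (2 * θ i) * c1
    · rw [polarPoint_one, polarPoint_one, Real.sin_add, Real.sin_add]
      linear_combination Real.cos (2 * θ i) * c1 + Real.sin (2 * θ i) * c0
  have hlen : ∀ i, ‖p (finRotate n i) - p i‖ = 2 * b * Real.sin (θ i) := fun i => by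
    rw [hrot' i, hφ i, norm_polarPoint_sub hb.le (hsθ i).le]
  refine ⟨θ, fun i => ⟨hθ0 i, hθ1 i, ?_⟩, ?_, fun i => ?_, ?_⟩
  · have := hp.le_det i
    rw [hlen, hrot' i, hφ i, planeDet_polarPoint, add_sub_cancel_left] at this
    exact (cos_le_of_admissible_side hb (hsθ i)).1 this
  · have hn := hp.convex.1
    exact sum_half_angles_eq_pi hp.convex hb hθ0 hθ1 hrot (φ₀ := φ ⟨0, by omega⟩) fun h => hφ _
  · rw [sideLength_eq_norm, hlen]
  · refine Finset.sum_congr rfl fun i _ => ?_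
    rw [hrot' i, hφ i, sideJ_polarPoint hb.le (hsθ i).le]

/-- The inscribed polygon whose sides have given half-angles. -/
noncomputable def inscribedPolygon (b : ℝ) (θ : Fin n → ℝ) : Polygon Plane n :=
  ⟨fun i => polarPoint b (angleSum θ i)⟩

theorem inscribedPolygon_apply (b : ℝ) (θ : Fin n → ℝ) (i : Fin n) :
    inscribedPolygon b θ i = polarPoint b (angleSum θ i) := rfl

theorem inscribedPolygon_next (b : ℝ) {θ : Fin n → ℝ} (hsum : ∑ i, θ i = Real.pi) (i : Fin n) :
    inscribedPolygon b θ (finRotate n i) = polarPoint b (angleSum θ i + 2 * θ i) := by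
  rw [← angleSum_succ]
  by_cases h : (i : ℕ) + 1 < n
  · rw [finRotate_val_of_lt h]; rfl
  · have h : (i : ℕ) + 1 = n := by omega
    rw [finRotate_val_of_eq h, h, angleSum_last, hsum, inscribedPolygon_apply, angleSum_zero,
      ← zero_add (2 * Real.pi), polarPoint_add_two_pi]

/-- Partial angle sums increase strictly from 0 to 2π. The last two sines in `planeDet_chords` are
therefore both negative for a vertex before the side and both positive for one after it. -/
theorem inscribedPolygon_isAdmissible (hn : 3 ≤ n) (hb : 0 < b) {θ : Fin n → ℝ}
    (hθ : ∀ i, 0 < θ i ∧ θ i < Real.pi / 2 ∧ a ≤ b * Real.cos (θ i))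
    (hsum : ∑ i, θ i = Real.pi) : IsAdmissible a b (inscribedPolygon b θ) := by
  have hpi := Real.pi_pos
  have hsθ : ∀ i, 0 < Real.sin (θ i) := fun i =>
    Real.sin_pos_of_pos_of_lt_pi (hθ i).1 (by linarith [(hθ i).2.1])
  have hθ0 : ∀ i, 0 < θ i := fun i => (hθ i).1
  have hlast : angleSum θ n = 2 * Real.pi := by rw [angleSum_last, hsum]
  refine ⟨⟨hn, fun i k h1 h2 => ?_⟩, fun i => ?_, fun i => ?_⟩
  · rw [inscribedPolygon_next b hsum, inscribedPolygon_apply, inscribedPolygon_apply]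
    have e : polarPoint b (angleSum θ k) =
        polarPoint b (angleSum θ i + 2 * ((angleSum θ k - angleSum θ i) / 2)) := by
      congr 1; ring
    rw [e, planeDet_chords]
    have es := angleSum_succ θ i
    rw [show (angleSum θ k - angleSum θ i) / 2 - θ i = (angleSum θ k - angleSum θ (i + 1)) / 2 by
      rw [es]; ring]
    have hk := angleSum_lt hθ0 k.2 le_rfl
    have hi := angleSum_lt hθ0 i.2 le_rfl
    have hk0 : 0 ≤ angleSum θ k := by
      rcases Nat.eq_zero_or_pos (k : ℕ) with h | h
      · rw [h, angleSum_zero]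
      · have := angleSum_lt hθ0 h k.2.le; rw [angleSum_zero] at this; exact this.le
    have hi0 : 0 ≤ angleSum θ i := by
      rcases Nat.eq_zero_or_pos (i : ℕ) with h | h
      · rw [h, angleSum_zero]
      · have := angleSum_lt hθ0 h i.2.le; rw [angleSum_zero] at this; exact this.le
    have hpre : 0 < 4 * b ^ 2 * Real.sin (θ i) := by have := hsθ i; positivity
    have hti := hθ0 i
    rcases lt_or_gt_of_ne (fun e => h1 (Fin.ext e) : (k : ℕ) ≠ i) with hki | hki
    · have l1 := angleSum_lt hθ0 hki i.2.le
      have l2 : angleSum θ (i + 1) - angleSum θ k < 2 * Real.pi := by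
        by_cases h : (i : ℕ) + 1 < n
        · have := angleSum_lt hθ0 h le_rfl; linarith
        · have h : (i : ℕ) + 1 = n := by omega
          rw [h, hlast]
          have : 0 < (k : ℕ) := by
            rw [finRotate_val_of_eq h] at h2
            exact Nat.pos_of_ne_zero fun e => h2 (Fin.ext e)
          have := angleSum_lt hθ0 this k.2.le
          rw [angleSum_zero] at this
          linarith
      have s1 : Real.sin ((angleSum θ k - angleSum θ (i + 1)) / 2) < 0 :=
        Real.sin_neg_of_neg_of_neg_pi_lt (by linarith) (by linarith)
      have s2 : Real.sin ((angleSum θ k - angleSum θ i) / 2) < 0 :=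
        Real.sin_neg_of_neg_of_neg_pi_lt (by linarith) (by linarith)
      exact mul_pos_of_neg_of_neg (mul_neg_of_pos_of_neg hpre s1) s2
    · have hki' : (i : ℕ) + 1 < k := by
        rcases eq_or_lt_of_le (Nat.succ_le_of_lt hki) with h | h
        · exfalso; apply h2
          rw [finRotate_val_of_lt (i := i) (by have := k.2; omega)]
          exact Fin.ext h.symm
        · exact h
      have l1 := angleSum_lt hθ0 hki' k.2.le
      have s1 : 0 < Real.sin ((angleSum θ k - angleSum θ (i + 1)) / 2) :=
        Real.sin_pos_of_pos_of_lt_pi (by linarith) (by linarith)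
      have s2 : 0 < Real.sin ((angleSum θ k - angleSum θ i) / 2) :=
        Real.sin_pos_of_pos_of_lt_pi (by linarith) (by linarith)
      exact mul_pos (mul_pos hpre s1) s2
  · rw [inscribedPolygon_apply, norm_polarPoint hb.le]
  · rw [inscribedPolygon_next b hsum, inscribedPolygon_apply, norm_polarPoint_sub hb.le (hsθ i).le,
      planeDet_polarPoint, add_sub_cancel_left]
    exact (cos_le_of_admissible_side hb (hsθ i)).2 (hθ i).2.2

theorem polyJ_inscribedPolygon (hb : 0 < b) {θ : Fin n → ℝ}
    (hθ : ∀ i, 0 < θ i ∧ θ i < Real.pi / 2) (hsum : ∑ i, θ i = Real.pi) :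
    polyJ lam (inscribedPolygon b θ) = ∑ i, chordJ b lam (θ i) := by
  have hpi := Real.pi_pos
  refine Finset.sum_congr rfl fun i _ => ?_
  rw [inscribedPolygon_next b hsum, inscribedPolygon_apply, sideJ_polarPoint hb.le]
  exact (Real.sin_pos_of_pos_of_lt_pi (hθ i).1 (by linarith [(hθ i).2])).le

end

/-! ### Optimal half-angles: first- and second-order conditions. -/

section

variable {a b lam : ℝ}

/-- This exact second difference shows that, for `sin α > 0`, the local convexity of `chordJ` is
governed by the sign of `1 - 2 * lam * b * cos α`. -/
theorem chordJ_add_sub (b lam α t : ℝ) :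
    chordJ b lam (α + t) + chordJ b lam (α - t) - 2 * chordJ b lam α =
      4 * b * Real.sin α * (1 - Real.cos t) * (1 - lam * b * Real.cos α * (1 + Real.cos t)) := by
  simp only [chordJ, Real.sin_add, Real.cos_add, Real.sin_sub, Real.cos_sub]
  linear_combination (-2 * lam * b ^ 2 * Real.sin α * Real.cos α) * Real.sin_sq_add_cos_sq t

theorem hasDerivAt_chordJ (b lam θ : ℝ) :
    HasDerivAt (chordJ b lam)
      (lam * b ^ 2 * (2 * Real.cos θ ^ 2 - 1) - 2 * b * Real.cos θ) θ := by
  have h1 := (((Real.hasDerivAt_sin θ).mul (Real.hasDerivAt_cos θ)).const_mul (lam * b ^ 2)).sub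
    ((Real.hasDerivAt_sin θ).const_mul (2 * b))
  refine h1.congr_deriv ?_
  linear_combination (-(lam * b ^ 2)) * Real.sin_sq_add_cos_sq θ

/-- With `Real.sinc`, a second difference divided by `t ^ 2` extends continuously to `t = 0`. -/
theorem one_sub_cos_eq_sinc (t : ℝ) : 1 - Real.cos t = t ^ 2 / 2 * Real.sinc (t / 2) ^ 2 := by
  have h1 : Real.cos t = 1 - 2 * Real.sin (t / 2) ^ 2 := by
    have := Real.cos_two_mul (t / 2)
    rw [mul_div_cancel₀ _ two_ne_zero] at this
    linarith [Real.sin_sq_add_cos_sq (t / 2)]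
  rcases eq_or_ne t 0 with rfl | ht
  · simp
  · rw [h1, Real.sinc_of_ne_zero (by positivity)]
    field_simp; ring

theorem HasDerivAt.nonneg_of_eventually_le {G : ℝ → ℝ} {g : ℝ} (hG : HasDerivAt G g 0)
    (h : ∀ᶠ t in nhdsWithin (0 : ℝ) (Set.Ioi 0), G 0 ≤ G t) : 0 ≤ g := by
  have h1 := (hasDerivWithinAt_iff_tendsto_slope' (Set.self_notMem_Ioi)).1
    (hG.hasDerivWithinAt (s := Set.Ioi 0))
  refine ge_of_tendsto h1 ?_
  filter_upwards [h, self_mem_nhdsWithin] with t ht ht0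
  rw [slope_def_field]
  exact div_nonneg (by linarith) (by simpa using (le_of_lt ht0))

theorem sum_eq_of_eq_off {N : ℕ} (j : Fin N) {c : ℝ} {F : Fin N → ℝ} (h : ∀ i ≠ j, F i = c) :
    ∑ i, F i = ((N : ℝ) - 1) * c + F j := by
  rw [← Finset.add_sum_erase _ _ (Finset.mem_univ j),
    Finset.sum_congr rfl fun i hi => h i (Finset.ne_of_mem_erase hi), Finset.sum_const,
    Finset.card_erase_of_mem (Finset.mem_univ j), Finset.card_univ, Fintype.card_fin, nsmul_eq_mul,
    Nat.cast_pred (Fin.pos j)]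
  ring

/-- Trigonometric core of the localization of the parameter. -/
theorem one_add_cos_le {ν α β : ℝ} (hν : 2 ≤ ν) (hβ : 0 < β) (hβα : β < α)
    (hsum : ν * α + β = Real.pi) (hs : ν * Real.sin β ≤ Real.sin α) :
    1 + Real.cos (Real.pi / ν) ≤ Real.cos α + Real.cos β := by
  have hpi := Real.pi_pos
  have hν0 : 0 < ν := by linarith
  have e1 : Real.pi / ν = α + β / ν := by rw [← hsum]; field_simp
  have hle : Real.pi / ν ≤ Real.pi / 2 := by gcongr
  have hx0 : 0 < β / (2 * ν) := by positivity
  have hxx : β / ν = 2 * (β / (2 * ν)) := by field_simp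
  have c1 : Real.cos α - Real.cos (α + β / ν) =
      2 * Real.sin (α + β / (2 * ν)) * Real.sin (β / (2 * ν)) := by
    obtain ⟨x, hx⟩ : ∃ x, x = β / (2 * ν) := ⟨_, rfl⟩
    obtain ⟨γ, hγ⟩ : ∃ γ, γ = α + x := ⟨_, rfl⟩
    rw [hxx, ← hx, ← hγ, show α = γ - x by rw [hγ]; ring, show γ - x + 2 * x = γ + x by ring,
      Real.cos_sub, Real.cos_add]
    ring
  have c2 : 1 - Real.cos β = 2 * Real.sin (β / 2) ^ 2 := by
    have := Real.cos_two_mul (β / 2)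
    rw [mul_div_cancel₀ _ two_ne_zero] at this
    linarith [Real.sin_sq_add_cos_sq (β / 2)]
  have s1 : Real.sin α ≤ Real.sin (α + β / (2 * ν)) :=
    Real.sin_le_sin_of_le_of_le_pi_div_two (by linarith) (by linarith) (by linarith)
  have s2 : Real.sin (β / 2) ≤ ν * Real.sin (β / (2 * ν)) := by
    have hν1 : 0 ≤ 1 - 1 / ν := by rw [sub_nonneg, div_le_one hν0]; linarith
    have hν3 : 0 ≤ 1 / ν := by positivity
    have hm0 : (0 : ℝ) ∈ Set.Icc 0 Real.pi := ⟨le_rfl, hpi.le⟩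
    have hm1 : β / 2 ∈ Set.Icc 0 Real.pi := ⟨by linarith, by linarith⟩
    have hc := strictConcaveOn_sin_Icc.concaveOn.2 hm0 hm1 hν1 hν3 (by ring)
    simp only [smul_eq_mul, Real.sin_zero, mul_zero, zero_add] at hc
    rw [show 1 / ν * (β / 2) = β / (2 * ν) by field_simp] at hc
    calc Real.sin (β / 2) = ν * (1 / ν * Real.sin (β / 2)) := by field_simp
      _ ≤ _ := by gcongr
  have s3 : Real.sin (β / 2) ≤ Real.sin β :=
    Real.sin_le_sin_of_le_of_le_pi_div_two (by linarith) (by linarith) (by linarith)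
  have p1 : 0 < Real.sin (β / 2) := Real.sin_pos_of_pos_of_lt_pi (by linarith) (by linarith)
  have hb2 : β / (2 * ν) < Real.pi := by linarith
  have p2 : 0 < Real.sin (β / (2 * ν)) := Real.sin_pos_of_pos_of_lt_pi hx0 hb2
  -- The chain is 1 - cos β = 2 sin²(β/2) ≤ 2 sin β sin(β/2) ≤ 2ν sin β sin(β/(2ν)) ≤ 2 sin(α +
  -- β/(2ν)) sin(β/(2ν)) = cos α - cos(π/ν).
  have k1 : ν * Real.sin β * Real.sin (β / (2 * ν)) ≤
      Real.sin (α + β / (2 * ν)) * Real.sin (β / (2 * ν)) :=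
    mul_le_mul_of_nonneg_right (hs.trans s1) p2.le
  have k2 : Real.sin β * Real.sin (β / 2) ≤ Real.sin β * (ν * Real.sin (β / (2 * ν))) :=
    mul_le_mul_of_nonneg_left s2 (p1.le.trans s3)
  have k3 : Real.sin (β / 2) * Real.sin (β / 2) ≤ Real.sin β * Real.sin (β / 2) :=
    mul_le_mul_of_nonneg_right s3 p1.le
  rw [e1]
  nlinarith

/-- Half-angles `θ` of an optimal inscribed polygon. -/
structure IsOptimalAngles (a b lam : ℝ) {N : ℕ} (θ : Fin N → ℝ) : Prop where
  mem : ∀ i, 0 < θ i ∧ θ i < Real.pi / 2 ∧ a ≤ b * Real.cos (θ i)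
  sum : ∑ i, θ i = Real.pi
  le : ∀ θ' : Fin N → ℝ, (∀ i, 0 < θ' i ∧ θ' i < Real.pi / 2 ∧ a ≤ b * Real.cos (θ' i)) →
    ∑ i, θ' i = Real.pi → ∑ i, chordJ b lam (θ i) ≤ ∑ i, chordJ b lam (θ' i)

/-- The strict bounds 0 and π/2 persist for small `t`, so only the inner constraint needs checking.
The filter `l` may be one-sided, for use when that constraint is active. -/
theorem IsOptimalAngles.eventually_le {N : ℕ} {θ : Fin N → ℝ} (h : IsOptimalAngles a b lam θ)
    {δ : Fin N → ℝ} (hδ : ∑ i, δ i = 0) {l : Filter ℝ} (hl : l ≤ nhds 0)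
    (hcos : ∀ i, ∀ᶠ t in l, a ≤ b * Real.cos (θ i + t * δ i)) :
    ∀ᶠ t in l, ∑ i, chordJ b lam (θ i) ≤ ∑ i, chordJ b lam (θ i + t * δ i) := by
  have h1 : ∀ i, ∀ᶠ t in l, 0 < θ i + t * δ i ∧ θ i + t * δ i < Real.pi / 2 := fun i => by
    have hc : Continuous fun t : ℝ => θ i + t * δ i := by fun_prop
    refine hl (((hc.continuousAt (x := 0)).eventually (lt_mem_nhds ?_)).and
      ((hc.continuousAt (x := 0)).eventually (gt_mem_nhds ?_)))
    · simpa using (h.mem i).1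
    · simpa using (h.mem i).2.1
  filter_upwards [Filter.eventually_all.2 h1, Filter.eventually_all.2 hcos] with t ht1 ht2
  refine h.le _ (fun i => ⟨(ht1 i).1, (ht1 i).2, ht2 i⟩) ?_
  rw [Finset.sum_add_distrib, ← Finset.mul_sum, hδ, mul_zero, add_zero, h.sum]

theorem eventually_le_cos {θ : ℝ} (h : a < b * Real.cos θ) (δ : ℝ) :
    ∀ᶠ t in nhds (0 : ℝ), a ≤ b * Real.cos (θ + t * δ) := by
  have hc : Continuous fun t : ℝ => b * Real.cos (θ + t * δ) := by fun_prop
  filter_upwards [(hc.continuousAt (x := 0)).eventually (lt_mem_nhds (by simpa using h))] with t ht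
  exact ht.le

theorem eventually_le_cos_of_neg (hb : 0 < b) {θ δ : ℝ} (h0 : 0 < θ) (hθ : θ < Real.pi / 2)
    (h : a ≤ b * Real.cos θ) (hδ : δ < 0) :
    ∀ᶠ t in nhdsWithin (0 : ℝ) (Set.Ioi 0), a ≤ b * Real.cos (θ + t * δ) := by
  have hc : Continuous fun t : ℝ => θ + t * δ := by fun_prop
  have := (hc.continuousAt (x := 0)).eventually (lt_mem_nhds (a := 0) (by simpa using h0))
  filter_upwards [nhdsWithin_le_nhds this, self_mem_nhdsWithin] with t ht1 ht2
  have hpi := Real.pi_pos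
  have : t * δ < 0 := mul_neg_of_pos_of_neg ht2 hδ
  refine h.trans (mul_le_mul_of_nonneg_left ?_ hb.le)
  exact Real.cos_le_cos_of_nonneg_of_le_pi ht1.le (by linarith) (by linarith)

/-- A half-angle that occurs twice is in the convexity region of `chordJ`. -/
theorem IsOptimalAngles.cos_le_of_eq {N : ℕ} {θ : Fin N → ℝ} (h : IsOptimalAngles a b lam θ)
    (hb : 0 < b) (hab : 2 * lam * a < 1) (hlam : 0 < lam) {i k : Fin N} (hik : i ≠ k)
    (he : θ i = θ k) : 2 * lam * b * Real.cos (θ i) ≤ 1 := by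
  by_contra hcon
  have hcon := not_le.1 hcon
  have hpi := Real.pi_pos
  -- From `2 * lam * a < 1` the inner constraint is inactive at both angles, so angle may be
  -- transferred between the two sides in either direction.
  have ha : a < b * Real.cos (θ i) := by
    have : 2 * lam * a < 2 * lam * (b * Real.cos (θ i)) := by linarith
    exact lt_of_mul_lt_mul_left this (by positivity)
  let δ : Fin N → ℝ := Pi.single i 1 - Pi.single k 1
  have hδ : ∑ m, δ m = 0 := by simp [δ]
  have δi : δ i = 1 := by simp [δ, hik]
  have δk : δ k = -1 := by simp [δ, hik.symm]
  have δo : ∀ m, m ≠ i → m ≠ k → δ m = 0 := fun m h1 h2 => by simp [δ, h1, h2]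
  have hev := h.eventually_le hδ (l := nhds 0) le_rfl fun m => by
    by_cases h1 : m = i
    · rw [h1]; exact eventually_le_cos ha _
    by_cases h2 : m = k
    · rw [h2]; exact eventually_le_cos (by rw [← he]; exact ha) _
    simp only [δo m h1 h2, mul_zero, add_zero]
    exact Filter.Eventually.of_forall fun _ => (h.mem m).2.2
  have hc : Continuous fun t : ℝ => lam * b * Real.cos (θ i) * (1 + Real.cos t) := by fun_prop
  have hev2 := (hc.continuousAt (x := 0)).eventually
    (lt_mem_nhds (a := 1) (by simp only [Real.cos_zero]; linarith))
  have hev3 : ∀ᶠ t in nhds (0 : ℝ), t < Real.pi := gt_mem_nhds hpi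
  obtain ⟨t, ⟨⟨h1, h2⟩, h3⟩, h4⟩ := ((((hev.and hev2).and hev3).filter_mono
    nhdsWithin_le_nhds).and (self_mem_nhdsWithin (a := (0 : ℝ)) (s := Set.Ioi 0))).exists
  have h4 : 0 < t := h4
  rw [← sub_nonneg, ← Finset.sum_sub_distrib, Finset.sum_eq_add i k hik
    (fun m _ hm => by rw [δo m hm.1 hm.2, mul_zero, add_zero, sub_self]) (by simp) (by simp),
    δi, δk, ← he, mul_one, mul_neg_one, ← sub_eq_add_neg] at h1
  have hid := chordJ_add_sub b lam (θ i) t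
  have hs : 0 < Real.sin (θ i) :=
    Real.sin_pos_of_pos_of_lt_pi (h.mem i).1 (by linarith [(h.mem i).2.1])
  have hct : Real.cos t < 1 := by
    rw [← Real.cos_zero]; exact Real.cos_lt_cos_of_nonneg_of_le_pi le_rfl h3.le h4
  have : 4 * b * Real.sin (θ i) * (1 - Real.cos t) *
      (1 - lam * b * Real.cos (θ i) * (1 + Real.cos t)) < 0 :=
    mul_neg_of_pos_of_neg (mul_pos (by positivity) (by linarith)) (by linarith)
  linarith

/-- The parameter is localized by the number of sides of an optimal quasi-regular polygon. -/
theorem IsOptimalAngles.localization {N : ℕ} (hN : 3 ≤ N) {θ : Fin N → ℝ}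
    (h : IsOptimalAngles a b lam θ) (ha : 0 < a) (hab : a < b) (hlam : 0 < lam)
    (hlamab : lam * (a + b) ≤ 1) {j : Fin N} {α : ℝ} (hα : ∀ i ≠ j, θ i = α) (hj : θ j ≠ α) :
    lam * b * (1 + Real.cos (Real.pi / ((N : ℝ) - 1))) ≤ 1 ∧
      1 < lam * b * (1 + Real.cos (Real.pi / N)) := by
  have hb : 0 < b := ha.trans hab
  have hpi := Real.pi_pos
  have hN' : (3 : ℝ) ≤ N := by exact_mod_cast hN
  obtain ⟨ν, hν⟩ : ∃ ν : ℝ, ν = (N : ℝ) - 1 := ⟨_, rfl⟩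
  have hν2 : 2 ≤ ν := by linarith
  have hν0 : 0 < ν := by linarith
  obtain ⟨β, hβ⟩ : ∃ β, β = θ j := ⟨_, rfl⟩
  rw [← hβ] at hj
  have hij : finRotate N j ≠ j := finRotate_ne_self (by omega) j
  have hkj : finRotate N (finRotate N j) ≠ j := finRotate_finRotate_ne_self hN j
  have hki := finRotate_ne_self (show 2 ≤ N by omega) (finRotate N j)
  obtain ⟨α0, α1, α2⟩ : 0 < α ∧ α < Real.pi / 2 ∧ a ≤ b * Real.cos α := by
    rw [← hα _ hij]; exact h.mem _
  obtain ⟨β0, β1, β2⟩ : 0 < β ∧ β < Real.pi / 2 ∧ a ≤ b * Real.cos β := by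
    rw [hβ]; exact h.mem _
  have hlamb : 0 < lam * b := mul_pos hlam hb
  have hla : 2 * lam * a < 1 := by
    have : lam * a < lam * b := mul_lt_mul_of_pos_left hab hlam
    linarith
  have hsum : ν * α + β = Real.pi := by
    rw [← h.sum, sum_eq_of_eq_off j hα, hν, hβ]
  have hconv : 2 * lam * b * Real.cos α ≤ 1 := by
    have := h.cos_le_of_eq hb hla hlam hki.symm (by rw [hα _ hij, hα _ hkj])
    rwa [hα _ hij] at this
  -- the one-parameter family `(α - s t / ν, …, α - s t / ν, β + s t)`
  let δ : ℝ → Fin N → ℝ := fun s i => if i = j then s else -s / ν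
  have δj : ∀ s, δ s j = s := fun s => if_pos rfl
  have δo : ∀ s, ∀ i ≠ j, δ s i = -s / ν := fun s i hi => if_neg hi
  have hδ : ∀ s, ∑ i, δ s i = 0 := fun s => by
    rw [sum_eq_of_eq_off j (δo s), δj, ← hν]; field_simp; ring
  let G : ℝ → ℝ → ℝ := fun s t => ν * chordJ b lam (α + t * (-s / ν)) + chordJ b lam (β + t * s)
  have hG : ∀ s t, ∑ i, chordJ b lam (θ i + t * δ s i) = G s t := fun s t => by
    rw [sum_eq_of_eq_off j (c := chordJ b lam (α + t * (-s / ν)))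
      fun i hi => by rw [hα i hi, δo s i hi], δj, ← hβ, ← hν]
  have hG0 : ∀ s, ∑ i, chordJ b lam (θ i) = G s 0 := fun s => by
    rw [← hG s 0]; simp
  have hev : ∀ (s : ℝ) (l : Filter ℝ), l ≤ nhds 0 →
      (∀ᶠ t in l, a ≤ b * Real.cos (α + t * (-s / ν))) →
      (∀ᶠ t in l, a ≤ b * Real.cos (β + t * s)) → ∀ᶠ t in l, G s 0 ≤ G s t := by
    intro s l hl h1 h2
    have := h.eventually_le (hδ s) hl fun i => by
      by_cases hi : i = j
      · rw [hi, δj, ← hβ]; exact h2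
      · rw [hα i hi, δo s i hi]; exact h1
    simpa only [hG, hG0 s] using this
  have hderiv : ∀ s, HasDerivAt (G s)
      (s * (2 * b * (Real.cos β - Real.cos α) *
        (lam * b * (Real.cos α + Real.cos β) - 1))) 0 := by
    intro s
    have d1 : HasDerivAt (fun t : ℝ => α + t * (-s / ν)) (-s / ν) 0 := by
      simpa using ((hasDerivAt_id (0 : ℝ)).mul_const (-s / ν)).const_add α
    have d2 : HasDerivAt (fun t : ℝ => β + t * s) s 0 := by
      simpa using ((hasDerivAt_id (0 : ℝ)).mul_const s).const_add β
    have f1 := (HasDerivAt.comp (h₂ := chordJ b lam) (0 : ℝ) (hasDerivAt_chordJ b lam _) d1).const_mul ν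
    have f2 := HasDerivAt.comp (h₂ := chordJ b lam) (0 : ℝ) (hasDerivAt_chordJ b lam _) d2
    refine (f1.add f2).congr_deriv ?_
    simp only [zero_mul, add_zero]
    field_simp
    ring
  rcases lt_or_gt_of_ne hj with hβα | hβα
  · have hcos : Real.cos α < Real.cos β :=
      Real.cos_lt_cos_of_nonneg_of_le_pi β0.le (by linarith) hβα
    have hβa : a < b * Real.cos β := lt_of_le_of_lt α2 (mul_lt_mul_of_pos_left hcos hb)
    have hcβ : Real.cos β < 1 := by
      rw [← Real.cos_zero]; exact Real.cos_lt_cos_of_nonneg_of_le_pi le_rfl (by linarith) β0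
    -- Enlarging the small angle and shrinking the others is admissible even when the constraint at
    -- `α` is active.
    have hd1 := (hderiv 1).nonneg_of_eventually_le (hev 1 _ nhdsWithin_le_nhds
      (eventually_le_cos_of_neg hb α0 α1 α2 (by rw [neg_div]; simpa using hν0))
      (nhdsWithin_le_nhds (eventually_le_cos hβa _)))
    have hge : 1 ≤ lam * b * (Real.cos α + Real.cos β) := by
      rw [one_mul] at hd1
      have : 0 < 2 * b * (Real.cos β - Real.cos α) := mul_pos (by positivity) (by linarith)
      linarith [nonneg_of_mul_nonneg_right hd1 this]
    -- If the constraint at `α` were active, `lam * b * (cos α + cos β)` would be less than `lam *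
    -- (a + b)`, hence less than 1, contrary to `hge`.
    have hαa : a < b * Real.cos α := by
      refine lt_of_le_of_ne α2 fun e => ?_
      have h1 : lam * b * Real.cos α = lam * a := by rw [e]; ring
      have h2 : lam * b * Real.cos β < lam * b * 1 := mul_lt_mul_of_pos_left hcβ hlamb
      linarith
    have hd2 := (hderiv (-1)).nonneg_of_eventually_le (hev (-1) _ nhdsWithin_le_nhds
      (nhdsWithin_le_nhds (eventually_le_cos hαa _))
      (nhdsWithin_le_nhds (eventually_le_cos hβa _)))
    have heq : lam * b * (Real.cos α + Real.cos β) = 1 := by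
      refine le_antisymm ?_ hge
      have : 0 < 2 * b * (Real.cos β - Real.cos α) := mul_pos (by positivity) (by linarith)
      by_contra hcon
      have := mul_pos this (show 0 < lam * b * (Real.cos α + Real.cos β) - 1 by linarith)
      linarith
    -- `E t` is the symmetric second difference of `G 1` divided by `t ^ 2`. At `t = 0`, the
    -- stationarity relation `heq` reduces it to a positive multiple of `sin α / ν - sin β`.
    have hsecond : ν * Real.sin β ≤ Real.sin α := by
      have e1 := hev 1 _ le_rfl (eventually_le_cos hαa _) (eventually_le_cos hβa _)
      have e2 := (continuous_neg.tendsto' (0 : ℝ) 0 neg_zero).eventually e1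
      let E : ℝ → ℝ := fun t =>
        2 * b * Real.sin β * Real.sinc (t / 2) ^ 2 * (1 - lam * b * Real.cos β * (1 + Real.cos t)) +
        2 * b * Real.sin α / ν * Real.sinc (t / ν / 2) ^ 2 *
          (1 - lam * b * Real.cos α * (1 + Real.cos (t / ν)))
      have hEc : Continuous E := by
        have := Real.continuous_sinc
        fun_prop
      have hE : ∀ᶠ t in nhdsWithin (0 : ℝ) (Set.Ioi 0), 0 ≤ E t := by
        filter_upwards [nhdsWithin_le_nhds e1, nhdsWithin_le_nhds e2, self_mem_nhdsWithin]
          with t h1 h2 ht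
        have ht : 0 < t := ht
        have i1 := chordJ_add_sub b lam β t
        have i2 := chordJ_add_sub b lam α (t / ν)
        rw [one_sub_cos_eq_sinc] at i1 i2
        have hid : G 1 t + G 1 (-t) - 2 * G 1 0 = t ^ 2 * E t := by
          simp only [G, E]
          rw [show α + t * (-1 / ν) = α - t / ν by ring, show α + -t * (-1 / ν) = α + t / ν by ring,
            zero_mul, zero_mul, add_zero, add_zero, mul_one, neg_mul, mul_one, ← sub_eq_add_neg]
          have : t ^ 2 * (2 * b * Real.sin α / ν * Real.sinc (t / ν / 2) ^ 2 *
              (1 - lam * b * Real.cos α * (1 + Real.cos (t / ν)))) =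
              ν * (4 * b * Real.sin α * ((t / ν) ^ 2 / 2 * Real.sinc (t / ν / 2) ^ 2) *
              (1 - lam * b * Real.cos α * (1 + Real.cos (t / ν)))) := by
            field_simp; ring
          linear_combination i1 + ν * i2 - this
        have : 0 ≤ t ^ 2 * E t := by rw [← hid]; linarith
        exact nonneg_of_mul_nonneg_right this (by positivity)
      have hE0 : 0 ≤ E 0 :=
        ge_of_tendsto (hEc.continuousAt.tendsto.mono_left nhdsWithin_le_nhds) hE
      simp only [E, zero_div, Real.sinc_zero, Real.cos_zero, one_pow, mul_one] at hE0
      have hD : 0 < 2 * b * (lam * b * (Real.cos β - Real.cos α)) :=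
        mul_pos (by positivity) (mul_pos hlamb (by linarith))
      have : 0 ≤ 2 * b * (lam * b * (Real.cos β - Real.cos α)) *
          (Real.sin α / ν - Real.sin β) := by
        refine le_of_le_of_eq hE0 ?_
        linear_combination (-(2 * b * Real.sin β) - 2 * b * Real.sin α / ν) * heq
      have := nonneg_of_mul_nonneg_right this hD
      rw [sub_nonneg, le_div_iff₀ hν0] at this
      linarith
    constructor
    · rw [← hν]
      exact (mul_le_mul_of_nonneg_left
        (one_add_cos_le hν2 β0 hβα hsum hsecond) hlamb.le).trans heq.le
    · refine heq.symm.trans_lt (mul_lt_mul_of_pos_left ?_ hlamb)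
      -- The mean of the half-angles is π/N, and the exceptional one is smaller than all the others.
      have hαN : Real.pi / N < α := by
        rw [div_lt_iff₀ (by linarith), show (N : ℝ) = ν + 1 by rw [hν]; ring]
        linarith
      have := Real.cos_lt_cos_of_nonneg_of_le_pi (by positivity) (by linarith) hαN
      linarith
  · exfalso
    have hcos : Real.cos β < Real.cos α :=
      Real.cos_lt_cos_of_nonneg_of_le_pi α0.le (by linarith) hβα
    have hαa : a < b * Real.cos α := lt_of_le_of_lt β2 (mul_lt_mul_of_pos_left hcos hb)
    -- Shrinking an exceptional angle larger than `α` is admissible and strictly lowers the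
    -- functional, because `hconv` gives `lam * b * (cos α + cos β) < 1`.
    have hd := (hderiv (-1)).nonneg_of_eventually_le (hev (-1) _ nhdsWithin_le_nhds
      (nhdsWithin_le_nhds (eventually_le_cos hαa _))
      (eventually_le_cos_of_neg hb β0 β1 β2 (by norm_num)))
    have h1 : 0 < 2 * b * (Real.cos α - Real.cos β) := mul_pos (by positivity) (by linarith)
    have h2 : lam * b * Real.cos β < lam * b * Real.cos α := mul_lt_mul_of_pos_left hcos hlamb
    have h3 := mul_neg_of_pos_of_neg h1
      (show lam * b * (Real.cos α + Real.cos β) - 1 < 0 by linarith)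
    linarith

theorem IsOptimalSet.localization {K : Set Plane} {N : ℕ} (ha : 0 < a) (hab : a < b)
    (hlam : 0 < lam) (hlamab : lam * (a + b) ≤ 1) (hK : IsOptimalSet a b lam K)
    (hq : IsQuasiRegularNGon N K) :
    3 ≤ N ∧ lam * b * (1 + Real.cos (Real.pi / ((N : ℝ) - 1))) ≤ 1 ∧
      1 < lam * b * (1 + Real.cos (Real.pi / N)) := by
  obtain ⟨p, hp, rfl, j, l, hl, hj⟩ := hq
  have hb : 0 < b := ha.trans hab
  have hpi := Real.pi_pos
  have hopt : IsOptimalPolygon a b lam p := IsOptimalSet.isOptimalPolygon ha hp hK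
  obtain ⟨θ, hθ, hsum, hlen, hJ⟩ := hopt.1.exists_half_angles (lam := lam) ha hb
    (hopt.norm_eq ha hb hlam hlamab)
  have hang : IsOptimalAngles a b lam θ := by
    refine ⟨hθ, hsum, fun θ' hθ' hsum' => ?_⟩
    rw [← hJ, ← polyJ_inscribedPolygon hb (fun i => ⟨(hθ' i).1, (hθ' i).2.1⟩) hsum']
    exact hopt.2 N _ (inscribedPolygon_isAdmissible hp.1 hb hθ' hsum')
  have hinj : ∀ i k, sideLength p i = sideLength p k → θ i = θ k := fun i k e => by
    rw [hlen, hlen] at e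
    have := mul_left_cancel₀ (by positivity) e
    exact Real.injOn_sin ⟨by linarith [(hθ i).1], (hθ i).2.1.le⟩
      ⟨by linarith [(hθ k).1], (hθ k).2.1.le⟩ this
  have hij : finRotate N j ≠ j := finRotate_ne_self (by have := hp.1; omega) j
  refine ⟨hp.1, hang.localization hp.1 ha hab hlam hlamab (j := j) (α := θ (finRotate N j))
    (fun i hi => hinj _ _ (by rw [hl i hi, hl _ hij])) fun e => hj ?_⟩
  rw [hlen, e, ← hlen, hl _ hij]

end

/-! ### Disjointness of the parameter intervals. -/

theorem corollary3p6 (a b lam : ℝ) (ha : 0 < a) (hab : a < b)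
    (hlam₁ : 1 / (2 * b) < lam) (hlam₂ : lam ≤ 1 / (a + b)) :
    ∀ N M : ℕ,
      (∃ K : Set Plane, IsOptimalSet a b lam K ∧ IsQuasiRegularNGon N K) →
      (∃ K : Set Plane, IsOptimalSet a b lam K ∧ IsQuasiRegularNGon M K) →
      N = M := by
  have hb : 0 < b := ha.trans hab
  have hlam : 0 < lam := lt_trans (by positivity) hlam₁
  have hlamab : lam * (a + b) ≤ 1 := (le_div_iff₀ (by positivity)).1 hlam₂
  have hpi := Real.pi_pos
  have key : ∀ N M : ℕ,
      (∃ K : Set Plane, IsOptimalSet a b lam K ∧ IsQuasiRegularNGon N K) →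
      (∃ K : Set Plane, IsOptimalSet a b lam K ∧ IsQuasiRegularNGon M K) → ¬ N < M := by
    rintro N M ⟨K, hK, hKN⟩ ⟨L, hL, hLM⟩ hNM
    obtain ⟨hN, -, h1⟩ := hK.localization ha hab hlam hlamab hKN
    obtain ⟨hM, h2, -⟩ := hL.localization ha hab hlam hlamab hLM
    have hN' : (3 : ℝ) ≤ N := by exact_mod_cast hN
    have hle : (N : ℝ) ≤ (M : ℝ) - 1 := by
      have : (N : ℝ) + 1 ≤ M := by exact_mod_cast hNM
      linarith
    have hdiv : Real.pi / ((M : ℝ) - 1) ≤ Real.pi / N :=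
      div_le_div_of_nonneg_left hpi.le (by linarith) hle
    have hcos : Real.cos (Real.pi / N) ≤ Real.cos (Real.pi / ((M : ℝ) - 1)) :=
      Real.cos_le_cos_of_nonneg_of_le_pi (div_nonneg hpi.le (by linarith))
        (div_le_self hpi.le (by linarith)) hdiv
    have := mul_le_mul_of_nonneg_left hcos (mul_pos hlam hb).le
    linarith
  intro N M hN hM
  exact le_antisymm (not_lt.1 (key M N hM hN)) (not_lt.1 (key N M hN hM))
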